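/- **The calculus $F_{<:Q}$.** All syntax is taken up to renaming of bound variables. There are three kinds of variables: term variables $x$, type variables $X$, qualifier variables $Y$. - Qualifiers: $P,Q,R ::= \top \mid \bot \mid Y \mid Q\wedge R \mid Q\vee R$. - Simple types: $S ::= \top \mid X \mid T_1\to T_2 \mid \forall(X<:S).T \mid \forall(Y<:Q).T$. Qualified types: $T,U ::= \{Q\}\,S$. - Terms: $s,t ::= x \mid \lambda(x)_P.t \mid s(t) \mid \Lambda(X<:S)_P.t \mid s[S] \mid \Lambda(Y<:Q)_P.t \mid s\{\!\{Q\}\!\} \mid \mathsf{upqual}\,P\,s \mid \mathsf{assert}\,P\,s$. Values $v$ are the three forms of abstraction; the subscript $P$ is the tag of the value. - Environments: $\Gamma ::= \cdot \mid \Gamma,x:T \mid \Gamma,X<:S \mid \Gamma,Y<:Q$. Qualifiers, types and environments are well-formed if all their free variables are bound in the (preceding part of the) environment. In the judgements below, all environments, types and qualifiers are required to be well-formed. *Reduction* $s\longrightarrow t$. For a qualifier $Q$ without variables let $\mathrm{eval}(Q)$ be its value in the two-point lattice $\{\bot\sqsubseteq\top\}$; $\mathrm{eval}(Q)$ is undefined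 if $Q$ contains a variable. The rules are $(\lambda(x)_P.t)(v)\longrightarrow t[x\mapsto v]$; $(\Lambda(X<:S)_P.t)[S']\longrightarrow t[X\mapsto S']$; $(\Lambda(Y<:Q)_P.t)\{\!\{Q'\}\!\}\longrightarrow t[Y\mapsto Q']$; and, for a value $v$ with tag $P$ such that $\mathrm{eval}(P)$ and $\mathrm{eval}(R)$ are defined and $\mathrm{eval}(P)\sqsubseteq\mathrm{eval}(R)$: $\mathsf{upqual}\,R\,v\longrightarrow v'$, where $v'$ is $v$ with its tag replaced by $R$, and $\mathsf{assert}\,R\,v\longrightarrow v$. Reduction is closed under the evaluation contexts $E ::= [\,] \mid E(t) \mid v(E) \mid E[S] \mid E\{\!\{Q\}\!\} \mid \mathsf{upqual}\,P\,E \mid \mathsf{assert}\,P\,E$. *Subqualification* $\Gamma\vdash Q<:R$ is generated by: $\Gamma\vdash Q<:\top$; $\Gamma\vdash\bot<:Q$; $\Gamma\vdash Y<:Y$; if $(Y<:Q)\in\Gamma$ and $\Gamma\vdash Q<:R$, then $\Gamma\vdash Y<:R$; if $\Gamma\vdash Q<:R_i$ for some $i\in\{1,2\}$, then $\Gamma\vdash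 Q<:R_1\vee R_2$; if $\Gamma\vdash Q_1<:R$ and $\Gamma\vdash Q_2<:R$, then $\Gamma\vdash Q_1\vee Q_2<:R$; if $\Gamma\vdash Q_i<:R$ for some $i\in\{1,2\}$, then $\Gamma\vdash Q_1\wedge Q_2<:R$; if $\Gamma\vdash Q<:R_1$ and $\Gamma\vdash Q<:R_2$, then $\Gamma\vdash Q<:R_1\wedge R_2$. *Subtyping* is generated by: $\Gamma\vdash S<:\top$; $\Gamma\vdash X<:X$; if $(X<:S)\in\Gamma$ and $\Gamma\vdash S<:S'$, then $\Gamma\vdash X<:S'$; if $\Gamma\vdash U_1<:T_1$ and $\Gamma\vdash T_2<:U_2$, then $\Gamma\vdash T_1\to T_2<:U_1\to U_2$; if $\Gamma\vdash S_2<:S_1$ and $\Gamma,X<:S_2\vdash T_1<:T_2$, then $\Gamma\vdash\forall(X<:S_1).T_1<:\forall(X<:S_2).T_2$; if $\Gamma\vdash Q_2<:Q_1$ and $\Gamma,Y<:Q_2\vdash T_1<:T_2$, then $\Gamma\vdash\forall(Y<:Q_1).T_1<:\forall(Y<:Q_2).T_2$; if $\Gamma\vdash Q_1<:Q_2$ and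 $\Gamma\vdash S_1<:S_2$, then $\Gamma\vdash\{Q_1\}S_1<:\{Q_2\}S_2$. *Typing* $\Gamma\vdash t:T$ is generated by: if $(x:T)\in\Gamma$, then $\Gamma\vdash x:T$; if $\Gamma,x:T_1\vdash t:T_2$, then $\Gamma\vdash\lambda(x)_P.t:\{P\}(T_1\to T_2)$; if $\Gamma,X<:S\vdash t:T$, then $\Gamma\vdash\Lambda(X<:S)_P.t:\{P\}\,\forall(X<:S).T$; if $\Gamma,Y<:Q\vdash t:T$, then $\Gamma\vdash\Lambda(Y<:Q)_P.t:\{P\}\,\forall(Y<:Q).T$; if $\Gamma\vdash s:\{Q\}(T_1\to T_2)$ and $\Gamma\vdash t:T_1$, then $\Gamma\vdash s(t):T_2$; if $\Gamma\vdash s:\{Q\}\,\forall(X<:S).T$ and $\Gamma\vdash S'<:S$, then $\Gamma\vdash s[S']:T[X\mapsto S']$; if $\Gamma\vdash s:\{R\}\,\forall(Y<:Q).T$ and $\Gamma\vdash Q'<:Q$, then $\Gamma\vdash s\{\!\{Q'\}\!\}:T[Y\mapsto Q']$; if $\Gamma\vdash s:\{Q\}S$ and $\Gamma\vdash Q<:P$,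 then $\Gamma\vdash\mathsf{assert}\,P\,s:\{Q\}S$ and $\Gamma\vdash\mathsf{upqual}\,P\,s:\{P\}S$; if $\Gamma\vdash s:T_1$ and $\Gamma\vdash T_1<:T_2$, then $\Gamma\vdash s:T_2$. **Theorem (Preservation for $F_{<:Q}$).** Let $\Gamma$ be an environment, $s,t$ terms and $T$ a qualified type. If $\Gamma\vdash s:T$ and $s\longrightarrow t$, then $\Gamma\vdash t:T$. -/

import Mathlib

/-!
The calculus `F<:Q`: System F-sub with type qualifiers and with bounded polymorphism over simple
types and over qualifiers.

Terms, types and qualifiers are represented up to renaming of bound variables by de Bruijn indices,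
with three separate index spaces: term variables `x`, type variables `X`, qualifier variables `Y`.
A term binder shifts only term variables, a type binder only type variables, a qualifier binder
only qualifier variables.
-/

namespace FsubQ

/-! ### Qualifiers -/

/-- Qualifier expressions `P, Q, R ::= ⊤ | ⊥ | Y | Q ∧ R | Q ∨ R`: lattice formulas over the
two-point lattice, with qualifier variables.  They are ordered by `SubQual` below. -/
inductive Qual : Type
  | top : Qual
  | bot : Qual
  | var : ℕ → Qual
  | meet : Qual → Qual → Qual
  | join : Qual → Qual → Qual

/-- The concrete qualifier denoted by a qualifier expression, in the two-point lattice `Bool`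
(`⊥ = false`, `⊤ = true`).  It is undefined if the expression contains a variable. -/
def Qual.eval : Qual → Option Bool
  | .top => some ⊤
  | .bot => some ⊥
  | .var _ => none
  | .meet Q R => do
      let c ← Q.eval
      let d ← R.eval
      return c ⊓ d
  | .join Q R => do
      let c ← Q.eval
      let d ← R.eval
      return c ⊔ d

/-- Extension of a renaming of indices below a binder. -/
def liftRen (ξ : ℕ → ℕ) : ℕ → ℕ
  | 0 => 0
  | n + 1 => ξ n + 1

/-- Renaming of the qualifier variables of a qualifier. -/
def Qual.rename (ξ : ℕ → ℕ) : Qual → Qual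
  | .top => .top
  | .bot => .bot
  | .var Y => .var (ξ Y)
  | .meet Q R => .meet (Q.rename ξ) (R.rename ξ)
  | .join Q R => .join (Q.rename ξ) (R.rename ξ)

/-- Simultaneous substitution of qualifiers for the qualifier variables of a qualifier. -/
def Qual.subst (θ : ℕ → Qual) : Qual → Qual
  | .top => .top
  | .bot => .bot
  | .var Y => θ Y
  | .meet Q R => .meet (Q.subst θ) (R.subst θ)
  | .join Q R => .join (Q.subst θ) (R.subst θ)

/-- Extension of a qualifier substitution below a qualifier binder. -/
def Qual.lift (θ : ℕ → Qual) : ℕ → Qual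
  | 0 => .var 0
  | n + 1 => (θ n).rename Nat.succ

/-- The substitution that sends index `0` to `Q` and lowers all other indices by one. -/
def Qual.single (Q : Qual) : ℕ → Qual
  | 0 => Q
  | n + 1 => .var n

/-! ### Types -/

/-- The two classes of types: simple types `S` and qualified types `T`. -/
inductive Kind : Type
  | simple : Kind
  | qualified : Kind

/-- Simple types `S ::= ⊤ | X | T₁ → T₂ | ∀(X <: S). T | ∀(Y <: Q). T` and
qualified types `T ::= {Q} S`, as one inductive family.  In `all S T` index `0` of the type
variables is bound in `T`; in `qall Q T` index `0` of the qualifier variables is bound in `T`. -/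
inductive Ty : Kind → Type
  | top : Ty .simple
  | var : ℕ → Ty .simple
  | arrow : Ty .qualified → Ty .qualified → Ty .simple
  | all : Ty .simple → Ty .qualified → Ty .simple
  | qall : Qual → Ty .qualified → Ty .simple
  | qual : Qual → Ty .simple → Ty .qualified

/-- Simple (unqualified) types. -/
abbrev STy : Type := Ty .simple

/-- Qualified types. -/
abbrev QTy : Type := Ty .qualified

/-- Renaming of the type variables (`ρ`) and the qualifier variables (`ξ`) of a type. -/
def Ty.rename : {k : Kind} → (ℕ → ℕ) → (ℕ → ℕ) → Ty k → Ty k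
  | _, _, _, .top => .top
  | _, ρ, _, .var X => .var (ρ X)
  | _, ρ, ξ, .arrow T₁ T₂ => .arrow (T₁.rename ρ ξ) (T₂.rename ρ ξ)
  | _, ρ, ξ, .all S T => .all (S.rename ρ ξ) (T.rename (liftRen ρ) ξ)
  | _, ρ, ξ, .qall Q T => .qall (Q.rename ξ) (T.rename ρ (liftRen ξ))
  | _, ρ, ξ, .qual Q S => .qual (Q.rename ξ) (S.rename ρ ξ)

/-- Weakening of a type by a new type variable. -/
def Ty.shiftTy {k : Kind} (T : Ty k) : Ty k := T.rename Nat.succ id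

/-- Weakening of a type by a new qualifier variable. -/
def Ty.shiftQual {k : Kind} (T : Ty k) : Ty k := T.rename id Nat.succ

/-- Extension of a type substitution below a type binder. -/
def Ty.lift (τ : ℕ → STy) : ℕ → STy
  | 0 => .var 0
  | n + 1 => (τ n).shiftTy

/-- Simultaneous capture-avoiding substitution of simple types for type variables (`τ`) and of
qualifiers for qualifier variables (`θ`) in a type. -/
def Ty.subst : {k : Kind} → (ℕ → STy) → (ℕ → Qual) → Ty k → Ty k
  | _, _, _, .top => .top
  | _, τ, _, .var X => τ X
  | _, τ, θ, .arrow T₁ T₂ => .arrow (T₁.subst τ θ) (T₂.subst τ θ)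
  | _, τ, θ, .all S T => .all (S.subst τ θ) (T.subst (Ty.lift τ) θ)
  | _, τ, θ, .qall Q T =>
      .qall (Q.subst θ) (T.subst (fun n => (τ n).shiftQual) (Qual.lift θ))
  | _, τ, θ, .qual Q S => .qual (Q.subst θ) (S.subst τ θ)

/-- The substitution that sends index `0` to `S` and lowers all other indices by one. -/
def Ty.single (S : STy) : ℕ → STy
  | 0 => S
  | n + 1 => .var n

/-- `T[X ↦ S]`, for the outermost type variable `X` (index `0`). -/
def Ty.instTy {k : Kind} (T : Ty k) (S : STy) : Ty k := T.subst (Ty.single S) Qual.var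

/-- `T[Y ↦ Q]`, for the outermost qualifier variable `Y` (index `0`). -/
def Ty.instQual {k : Kind} (T : Ty k) (Q : Qual) : Ty k := T.subst Ty.var (Qual.single Q)

/-! ### Terms -/

/-- Terms: variables `x`, abstractions `λ(x)_P. t`, `Λ(X <: S)_P. t`, `Λ(Y <: Q)_P. t` carrying a
qualifier tag `P`, the three forms of application `s(t)`, `s[S]`, `s{{Q}}`, and the two operations
on tags, `upqual P s` and `assert P s`. -/
inductive Tm : Type
  | var : ℕ → Tm
  | abs : Qual → Tm → Tm
  | app : Tm → Tm → Tm
  | tabs : Qual → STy → Tm → Tm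
  | tapp : Tm → STy → Tm
  | qabs : Qual → Qual → Tm → Tm
  | qapp : Tm → Qual → Tm
  | upqual : Qual → Tm → Tm
  | assert : Qual → Tm → Tm

/-- Renaming of the term (`χ`), type (`ρ`) and qualifier (`ξ`) variables of a term. -/
def Tm.rename : (ℕ → ℕ) → (ℕ → ℕ) → (ℕ → ℕ) → Tm → Tm
  | χ, _, _, .var x => .var (χ x)
  | χ, ρ, ξ, .abs P t => .abs (P.rename ξ) (t.rename (liftRen χ) ρ ξ)
  | χ, ρ, ξ, .app s t => .app (s.rename χ ρ ξ) (t.rename χ ρ ξ)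
  | χ, ρ, ξ, .tabs P S t => .tabs (P.rename ξ) (S.rename ρ ξ) (t.rename χ (liftRen ρ) ξ)
  | χ, ρ, ξ, .tapp s S => .tapp (s.rename χ ρ ξ) (S.rename ρ ξ)
  | χ, ρ, ξ, .qabs P Q t => .qabs (P.rename ξ) (Q.rename ξ) (t.rename χ ρ (liftRen ξ))
  | χ, ρ, ξ, .qapp s Q => .qapp (s.rename χ ρ ξ) (Q.rename ξ)
  | χ, ρ, ξ, .upqual P s => .upqual (P.rename ξ) (s.rename χ ρ ξ)
  | χ, ρ, ξ, .assert P s => .assert (P.rename ξ) (s.rename χ ρ ξ)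

/-- Extension of a term substitution below a term binder. -/
def Tm.lift (σ : ℕ → Tm) : ℕ → Tm
  | 0 => .var 0
  | n + 1 => (σ n).rename Nat.succ id id

/-- Simultaneous capture-avoiding substitution for the term (`σ`), type (`τ`) and qualifier (`θ`)
variables of a term. -/
def Tm.subst : (ℕ → Tm) → (ℕ → STy) → (ℕ → Qual) → Tm → Tm
  | σ, _, _, .var x => σ x
  | σ, τ, θ, .abs P t => .abs (P.subst θ) (t.subst (Tm.lift σ) τ θ)
  | σ, τ, θ, .app s t => .app (s.subst σ τ θ) (t.subst σ τ θ)
  | σ, τ, θ, .tabs P S t =>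
      .tabs (P.subst θ) (S.subst τ θ)
        (t.subst (fun n => (σ n).rename id Nat.succ id) (Ty.lift τ) θ)
  | σ, τ, θ, .tapp s S => .tapp (s.subst σ τ θ) (S.subst τ θ)
  | σ, τ, θ, .qabs P Q t =>
      .qabs (P.subst θ) (Q.subst θ)
        (t.subst (fun n => (σ n).rename id id Nat.succ) (fun n => (τ n).shiftQual) (Qual.lift θ))
  | σ, τ, θ, .qapp s Q => .qapp (s.subst σ τ θ) (Q.subst θ)
  | σ, τ, θ, .upqual P s => .upqual (P.subst θ) (s.subst σ τ θ)
  | σ, τ, θ, .assert P s => .assert (P.subst θ) (s.subst σ τ θ)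

/-- The substitution that sends index `0` to `s` and lowers all other indices by one. -/
def Tm.single (s : Tm) : ℕ → Tm
  | 0 => s
  | n + 1 => .var n

/-- `t[x ↦ s]`, for the outermost term variable `x` (index `0`). -/
def Tm.instTm (t s : Tm) : Tm := t.subst (Tm.single s) Ty.var Qual.var

/-- `t[X ↦ S]`, for the outermost type variable `X` (index `0`). -/
def Tm.instTy (t : Tm) (S : STy) : Tm := t.subst Tm.var (Ty.single S) Qual.var

/-- `t[Y ↦ Q]`, for the outermost qualifier variable `Y` (index `0`). -/
def Tm.instQual (t : Tm) (Q : Qual) : Tm := t.subst Tm.var Ty.var (Qual.single Q)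

/-! ### Reduction -/

/-- Values are the three forms of tagged abstraction. -/
inductive Value : Tm → Prop
  | abs (P : Qual) (t : Tm) : Value (.abs P t)
  | tabs (P : Qual) (S : STy) (t : Tm) : Value (.tabs P S t)
  | qabs (P Q : Qual) (t : Tm) : Value (.qabs P Q t)

/-- `HasTag v P`: `v` is a value with qualifier tag `P`. -/
inductive HasTag : Tm → Qual → Prop
  | abs (P : Qual) (t : Tm) : HasTag (.abs P t) P
  | tabs (P : Qual) (S : STy) (t : Tm) : HasTag (.tabs P S t) P
  | qabs (P Q : Qual) (t : Tm) : HasTag (.qabs P Q t) P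

/-- Replacement of the tag of a value by `R`; other terms are left alone. -/
def Tm.retag (R : Qual) : Tm → Tm
  | .abs _ t => .abs R t
  | .tabs _ S t => .tabs R S t
  | .qabs _ Q t => .qabs R Q t
  | t => t

/-- `P` and `R` denote concrete qualifiers, and that of `P` is at most that of `R`. -/
def EvalLE (P R : Qual) : Prop :=
  ∃ c d : Bool, P.eval = some c ∧ R.eval = some d ∧ c ≤ d

/-- Call-by-value small-step reduction `s ⟶ t`. -/
inductive Step : Tm → Tm → Prop
  | beta_v (P : Qual) (t v : Tm) :
      Value v → Step (.app (.abs P t) v) (t.instTm v)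
  | beta_T (P : Qual) (S : STy) (t : Tm) (S' : STy) :
      Step (.tapp (.tabs P S t) S') (t.instTy S')
  | beta_Q (P Q : Qual) (t : Tm) (Q' : Qual) :
      Step (.qapp (.qabs P Q t) Q') (t.instQual Q')
  | upqual (P R : Qual) (v : Tm) :
      HasTag v P → EvalLE P R → Step (.upqual R v) (v.retag R)
  | assert (P R : Qual) (v : Tm) :
      HasTag v P → EvalLE P R → Step (.assert R v) v
  | app_fun (s s' t : Tm) : Step s s' → Step (.app s t) (.app s' t)
  | app_arg (v t t' : Tm) : Value v → Step t t' → Step (.app v t) (.app v t')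
  | tapp_congr (s s' : Tm) (S : STy) : Step s s' → Step (.tapp s S) (.tapp s' S)
  | qapp_congr (s s' : Tm) (Q : Qual) : Step s s' → Step (.qapp s Q) (.qapp s' Q)
  | upqual_congr (P : Qual) (s s' : Tm) : Step s s' → Step (.upqual P s) (.upqual P s')
  | assert_congr (P : Qual) (s s' : Tm) : Step s s' → Step (.assert P s) (.assert P s')

/-! ### Environments -/

/-- Bindings `x : T`, `X <: S` and `Y <: Q`. -/
inductive Binding : Type
  | tm : QTy → Binding
  | ty : STy → Binding
  | qu : Qual → Binding

/-- Environments `Γ`, most recent binding first; each binding refers to the variables bound in the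
tail that follows it. -/
abbrev Env : Type := List Binding

/-- `x : T ∈ Γ`, with `T` weakened to all of `Γ`. -/
inductive HasTm : Env → ℕ → QTy → Prop
  | here (Γ : Env) (T : QTy) : HasTm (.tm T :: Γ) 0 T
  | tm (Γ : Env) (T' : QTy) (x : ℕ) (T : QTy) : HasTm Γ x T → HasTm (.tm T' :: Γ) (x + 1) T
  | ty (Γ : Env) (S' : STy) (x : ℕ) (T : QTy) : HasTm Γ x T → HasTm (.ty S' :: Γ) x T.shiftTy
  | qu (Γ : Env) (Q' : Qual) (x : ℕ) (T : QTy) : HasTm Γ x T → HasTm (.qu Q' :: Γ) x T.shiftQual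

/-- `X <: S ∈ Γ`, with `S` weakened to all of `Γ`. -/
inductive HasTy : Env → ℕ → STy → Prop
  | here (Γ : Env) (S : STy) : HasTy (.ty S :: Γ) 0 S.shiftTy
  | tm (Γ : Env) (T' : QTy) (X : ℕ) (S : STy) : HasTy Γ X S → HasTy (.tm T' :: Γ) X S
  | ty (Γ : Env) (S' : STy) (X : ℕ) (S : STy) :
      HasTy Γ X S → HasTy (.ty S' :: Γ) (X + 1) S.shiftTy
  | qu (Γ : Env) (Q' : Qual) (X : ℕ) (S : STy) : HasTy Γ X S → HasTy (.qu Q' :: Γ) X S.shiftQual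

/-- `Y <: Q ∈ Γ`, with `Q` weakened to all of `Γ`. -/
inductive HasQu : Env → ℕ → Qual → Prop
  | here (Γ : Env) (Q : Qual) : HasQu (.qu Q :: Γ) 0 (Q.rename Nat.succ)
  | tm (Γ : Env) (T' : QTy) (Y : ℕ) (Q : Qual) : HasQu Γ Y Q → HasQu (.tm T' :: Γ) Y Q
  | ty (Γ : Env) (S' : STy) (Y : ℕ) (Q : Qual) : HasQu Γ Y Q → HasQu (.ty S' :: Γ) Y Q
  | qu (Γ : Env) (Q' : Qual) (Y : ℕ) (Q : Qual) :
      HasQu Γ Y Q → HasQu (.qu Q' :: Γ) (Y + 1) (Q.rename Nat.succ)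

/-! ### Well-formedness: all variables are bound in the environment -/

/-- Well-formed qualifiers. -/
inductive WfQual (Γ : Env) : Qual → Prop
  | top : WfQual Γ .top
  | bot : WfQual Γ .bot
  | var (Y : ℕ) (Q : Qual) : HasQu Γ Y Q → WfQual Γ (.var Y)
  | meet (Q R : Qual) : WfQual Γ Q → WfQual Γ R → WfQual Γ (.meet Q R)
  | join (Q R : Qual) : WfQual Γ Q → WfQual Γ R → WfQual Γ (.join Q R)

/-- Well-formed (simple or qualified) types. -/
inductive WfTy : {k : Kind} → Env → Ty k → Prop
  | top (Γ : Env) : WfTy Γ .top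
  | var (Γ : Env) (X : ℕ) (S : STy) : HasTy Γ X S → WfTy Γ (.var X)
  | arrow (Γ : Env) (T₁ T₂ : QTy) : WfTy Γ T₁ → WfTy Γ T₂ → WfTy Γ (.arrow T₁ T₂)
  | all (Γ : Env) (S : STy) (T : QTy) :
      WfTy Γ S → WfTy (.ty S :: Γ) T → WfTy Γ (.all S T)
  | qall (Γ : Env) (Q : Qual) (T : QTy) :
      WfQual Γ Q → WfTy (.qu Q :: Γ) T → WfTy Γ (.qall Q T)
  | qual (Γ : Env) (Q : Qual) (S : STy) : WfQual Γ Q → WfTy Γ S → WfTy Γ (.qual Q S)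

/-- Well-formed environments. -/
inductive WfEnv : Env → Prop
  | nil : WfEnv []
  | tm (Γ : Env) (T : QTy) : WfEnv Γ → WfTy Γ T → WfEnv (.tm T :: Γ)
  | ty (Γ : Env) (S : STy) : WfEnv Γ → WfTy Γ S → WfEnv (.ty S :: Γ)
  | qu (Γ : Env) (Q : Qual) : WfEnv Γ → WfQual Γ Q → WfEnv (.qu Q :: Γ)

/-! ### Subqualification, subtyping, typing

The axioms of each judgement require a well-formed environment, and the rules require those parts of
the conclusion to be well-formed that no premise mentions. -/

/-- Subqualification `Γ ⊢ Q <: R`. -/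
inductive SubQual (Γ : Env) : Qual → Qual → Prop
  | top (Q : Qual) : WfEnv Γ → WfQual Γ Q → SubQual Γ Q .top
  | bot (Q : Qual) : WfEnv Γ → WfQual Γ Q → SubQual Γ .bot Q
  | refl_var (Y : ℕ) : WfEnv Γ → WfQual Γ (.var Y) → SubQual Γ (.var Y) (.var Y)
  | var (Y : ℕ) (Q R : Qual) : HasQu Γ Y Q → SubQual Γ Q R → SubQual Γ (.var Y) R
  | join_intro_1 (Q R₁ R₂ : Qual) :
      SubQual Γ Q R₁ → WfQual Γ R₂ → SubQual Γ Q (.join R₁ R₂)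
  | join_intro_2 (Q R₁ R₂ : Qual) :
      WfQual Γ R₁ → SubQual Γ Q R₂ → SubQual Γ Q (.join R₁ R₂)
  | join_elim (Q₁ Q₂ R : Qual) :
      SubQual Γ Q₁ R → SubQual Γ Q₂ R → SubQual Γ (.join Q₁ Q₂) R
  | meet_elim_1 (Q₁ Q₂ R : Qual) :
      SubQual Γ Q₁ R → WfQual Γ Q₂ → SubQual Γ (.meet Q₁ Q₂) R
  | meet_elim_2 (Q₁ Q₂ R : Qual) :
      WfQual Γ Q₁ → SubQual Γ Q₂ R → SubQual Γ (.meet Q₁ Q₂) R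
  | meet_intro (Q R₁ R₂ : Qual) :
      SubQual Γ Q R₁ → SubQual Γ Q R₂ → SubQual Γ Q (.meet R₁ R₂)

/-- Subtyping `Γ ⊢ S₁ <: S₂` of simple types and `Γ ⊢ T₁ <: T₂` of qualified types. -/
inductive Sub : {k : Kind} → Env → Ty k → Ty k → Prop
  | top (Γ : Env) (S : STy) : WfEnv Γ → WfTy Γ S → Sub Γ S .top
  | refl_var (Γ : Env) (X : ℕ) :
      WfEnv Γ → WfTy Γ (.var X) → Sub Γ (.var X) (.var X)
  | var (Γ : Env) (X : ℕ) (S S' : STy) : HasTy Γ X S → Sub Γ S S' → Sub Γ (.var X) S'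
  | arrow (Γ : Env) (T₁ T₂ U₁ U₂ : QTy) :
      Sub Γ U₁ T₁ → Sub Γ T₂ U₂ → Sub Γ (.arrow T₁ T₂) (.arrow U₁ U₂)
  | all (Γ : Env) (S₁ S₂ : STy) (T₁ T₂ : QTy) :
      Sub Γ S₂ S₁ → Sub (.ty S₂ :: Γ) T₁ T₂ → Sub Γ (.all S₁ T₁) (.all S₂ T₂)
  | qall (Γ : Env) (Q₁ Q₂ : Qual) (T₁ T₂ : QTy) :
      SubQual Γ Q₂ Q₁ → Sub (.qu Q₂ :: Γ) T₁ T₂ → Sub Γ (.qall Q₁ T₁) (.qall Q₂ T₂)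
  | qtype (Γ : Env) (Q₁ Q₂ : Qual) (S₁ S₂ : STy) :
      SubQual Γ Q₁ Q₂ → Sub Γ S₁ S₂ → Sub Γ (.qual Q₁ S₁) (.qual Q₂ S₂)

/-- Typing `Γ ⊢ t : T`. -/
inductive Typing : Env → Tm → QTy → Prop
  | var (Γ : Env) (x : ℕ) (T : QTy) : WfEnv Γ → HasTm Γ x T → Typing Γ (.var x) T
  | abs (Γ : Env) (P : Qual) (t : Tm) (T₁ T₂ : QTy) :
      WfQual Γ P → Typing (.tm T₁ :: Γ) t T₂ →
      Typing Γ (.abs P t) (.qual P (.arrow T₁ T₂))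
  | t_abs (Γ : Env) (P : Qual) (S : STy) (t : Tm) (T : QTy) :
      WfQual Γ P → Typing (.ty S :: Γ) t T →
      Typing Γ (.tabs P S t) (.qual P (.all S T))
  | q_abs (Γ : Env) (P Q : Qual) (t : Tm) (T : QTy) :
      WfQual Γ P → Typing (.qu Q :: Γ) t T →
      Typing Γ (.qabs P Q t) (.qual P (.qall Q T))
  | app (Γ : Env) (Q : Qual) (s t : Tm) (T₁ T₂ : QTy) :
      Typing Γ s (.qual Q (.arrow T₁ T₂)) → Typing Γ t T₁ → Typing Γ (.app s t) T₂
  | t_app (Γ : Env) (Q : Qual) (s : Tm) (S S' : STy) (T : QTy) :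
      Typing Γ s (.qual Q (.all S T)) → Sub Γ S' S → Typing Γ (.tapp s S') (T.instTy S')
  | q_app (Γ : Env) (R : Qual) (s : Tm) (Q Q' : Qual) (T : QTy) :
      Typing Γ s (.qual R (.qall Q T)) → SubQual Γ Q' Q → Typing Γ (.qapp s Q') (T.instQual Q')
  | typ_assert (Γ : Env) (P Q : Qual) (s : Tm) (S : STy) :
      Typing Γ s (.qual Q S) → SubQual Γ Q P → Typing Γ (.assert P s) (.qual Q S)
  | typ_upqual (Γ : Env) (P Q : Qual) (s : Tm) (S : STy) :
      Typing Γ s (.qual Q S) → SubQual Γ Q P → Typing Γ (.upqual P s) (.qual P S)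
  | sub (Γ : Env) (s : Tm) (T₁ T₂ : QTy) :
      Typing Γ s T₁ → Sub Γ T₁ T₂ → Typing Γ s T₂

end FsubQ

namespace FsubQ

/-! ### Renaming and substitution in qualifiers -/

theorem liftRen_id : liftRen id = id := by
  funext n; cases n <;> rfl

theorem liftRen_comp (ξ ζ : ℕ → ℕ) : liftRen ζ ∘ liftRen ξ = liftRen (ζ ∘ ξ) := by
  funext n; cases n <;> rfl

theorem Qual.rename_id (Q : Qual) : Q.rename id = Q := by
  induction Q <;> simp_all [Qual.rename]

theorem Qual.rename_rename (ξ ζ : ℕ → ℕ) (Q : Qual) :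
    (Q.rename ξ).rename ζ = Q.rename (ζ ∘ ξ) := by
  induction Q <;> simp_all [Qual.rename]

theorem Qual.subst_var (Q : Qual) : Q.subst .var = Q := by
  induction Q <;> simp_all [Qual.subst]

theorem Qual.subst_rename (ξ : ℕ → ℕ) (θ : ℕ → Qual) (Q : Qual) :
    (Q.rename ξ).subst θ = Q.subst (θ ∘ ξ) := by
  induction Q <;> simp_all [Qual.rename, Qual.subst]

theorem Qual.rename_subst (θ : ℕ → Qual) (ξ : ℕ → ℕ) (Q : Qual) :
    (Q.subst θ).rename ξ = Q.subst (fun n => (θ n).rename ξ) := by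
  induction Q <;> simp_all [Qual.rename, Qual.subst]

theorem Qual.subst_subst (θ η : ℕ → Qual) (Q : Qual) :
    (Q.subst θ).subst η = Q.subst (fun n => (θ n).subst η) := by
  induction Q <;> simp_all [Qual.subst]

theorem Qual.lift_var : Qual.lift .var = .var := by
  funext n; cases n <;> rfl

theorem Qual.lift_comp_liftRen (θ : ℕ → Qual) (ξ : ℕ → ℕ) :
    (fun n => Qual.lift θ (liftRen ξ n)) = Qual.lift (fun n => θ (ξ n)) := by
  funext n; cases n <;> rfl

theorem Qual.lift_rename (θ : ℕ → Qual) (ξ : ℕ → ℕ) :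
    (fun n => (Qual.lift θ n).rename (liftRen ξ)) = Qual.lift (fun n => (θ n).rename ξ) := by
  funext n
  cases n with
  | zero => rfl
  | succ n => simp only [Qual.lift, Qual.rename_rename]; rfl

theorem Qual.lift_subst (θ η : ℕ → Qual) :
    (fun n => (Qual.lift θ n).subst (Qual.lift η)) = Qual.lift (fun n => (θ n).subst η) := by
  funext n
  cases n with
  | zero => rfl
  | succ n => simp only [Qual.lift, Qual.subst_rename, Qual.rename_subst]; rfl

/-! ### Renaming and substitution in types -/

theorem Ty.rename_id {k : Kind} (T : Ty k) : T.rename id id = T := by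
  induction T <;> simp_all [Ty.rename, liftRen_id, Qual.rename_id]

theorem Ty.rename_rename {k : Kind} (T : Ty k) (ρ ξ ρ' ξ' : ℕ → ℕ) :
    (T.rename ρ ξ).rename ρ' ξ' = T.rename (ρ' ∘ ρ) (ξ' ∘ ξ) := by
  induction T generalizing ρ ξ ρ' ξ' <;>
    simp_all [Ty.rename, liftRen_comp, Qual.rename_rename]

theorem Ty.lift_var : Ty.lift .var = .var := by
  funext n; cases n <;> rfl

theorem Ty.subst_var {k : Kind} (T : Ty k) : T.subst .var .var = T := by
  induction T <;>
    simp_all [Ty.subst, Ty.lift_var, Qual.lift_var, Qual.subst_var, Ty.shiftQual, Ty.rename]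

theorem Ty.lift_comp_liftRen (τ : ℕ → STy) (ρ : ℕ → ℕ) :
    (fun n => Ty.lift τ (liftRen ρ n)) = Ty.lift (fun n => τ (ρ n)) := by
  funext n; cases n <;> rfl

theorem Ty.subst_rename {k : Kind} (T : Ty k) (ρ ξ : ℕ → ℕ) (τ : ℕ → STy) (θ : ℕ → Qual) :
    (T.rename ρ ξ).subst τ θ = T.subst (τ ∘ ρ) (θ ∘ ξ) := by
  induction T generalizing ρ ξ τ θ <;>
    simp_all [Ty.rename, Ty.subst, Ty.lift_comp_liftRen, Qual.lift_comp_liftRen,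
      Qual.subst_rename, Function.comp_def]

theorem Ty.shiftTy_rename {k : Kind} (T : Ty k) (ρ ξ : ℕ → ℕ) :
    T.shiftTy.rename (liftRen ρ) ξ = (T.rename ρ ξ).shiftTy := by
  simp only [Ty.shiftTy, Ty.rename_rename]; rfl

theorem Ty.shiftQual_rename {k : Kind} (T : Ty k) (ρ ξ : ℕ → ℕ) :
    T.shiftQual.rename ρ (liftRen ξ) = (T.rename ρ ξ).shiftQual := by
  simp only [Ty.shiftQual, Ty.rename_rename]; rfl

theorem Ty.lift_rename (τ : ℕ → STy) (ρ ξ : ℕ → ℕ) :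
    (fun n => (Ty.lift τ n).rename (liftRen ρ) ξ) = Ty.lift (fun n => (τ n).rename ρ ξ) := by
  funext n
  cases n with
  | zero => rfl
  | succ n => exact Ty.shiftTy_rename _ _ _

theorem Ty.rename_subst {k : Kind} (T : Ty k) (τ : ℕ → STy) (θ : ℕ → Qual) (ρ ξ : ℕ → ℕ) :
    (T.subst τ θ).rename ρ ξ
      = T.subst (fun n => (τ n).rename ρ ξ) (fun n => (θ n).rename ξ) := by
  induction T generalizing τ θ ρ ξ <;>
    simp_all [Ty.rename, Ty.subst, Ty.lift_rename, Qual.lift_rename, Qual.rename_subst,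
      Ty.shiftQual_rename]

theorem Ty.shiftTy_subst {k : Kind} (T : Ty k) (τ : ℕ → STy) (θ : ℕ → Qual) :
    T.shiftTy.subst (Ty.lift τ) θ = (T.subst τ θ).shiftTy := by
  simp only [Ty.shiftTy, Ty.subst_rename, Ty.rename_subst, Qual.rename_id]; rfl

theorem Ty.shiftQual_subst {k : Kind} (T : Ty k) (τ : ℕ → STy) (θ : ℕ → Qual) :
    T.shiftQual.subst (fun n => (τ n).shiftQual) (Qual.lift θ) = (T.subst τ θ).shiftQual := by
  simp only [Ty.shiftQual, Ty.subst_rename, Ty.rename_subst]; rfl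

theorem Ty.lift_subst (τ σ : ℕ → STy) (θ : ℕ → Qual) :
    (fun n => (Ty.lift τ n).subst (Ty.lift σ) θ) = Ty.lift (fun n => (τ n).subst σ θ) := by
  funext n
  cases n with
  | zero => rfl
  | succ n => exact Ty.shiftTy_subst _ _ _

theorem Ty.subst_subst {k : Kind} (T : Ty k) (τ σ : ℕ → STy) (θ η : ℕ → Qual) :
    (T.subst τ θ).subst σ η
      = T.subst (fun n => (τ n).subst σ η) (fun n => (θ n).subst η) := by
  induction T generalizing τ σ θ η <;>
    simp_all [Ty.subst, Ty.lift_subst, Qual.lift_subst, Qual.subst_subst, Ty.shiftQual_subst]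

theorem Ty.shiftTy_instTy {k : Kind} (T : Ty k) (S : STy) : T.shiftTy.instTy S = T := by
  simp only [Ty.shiftTy, Ty.instTy, Ty.subst_rename]
  exact Ty.subst_var T

theorem Ty.shiftQual_instQual {k : Kind} (T : Ty k) (Q : Qual) : T.shiftQual.instQual Q = T := by
  simp only [Ty.shiftQual, Ty.instQual, Ty.subst_rename]
  exact Ty.subst_var T

theorem Qual.rename_succ_subst_single (Q R : Qual) : (Q.rename Nat.succ).subst (.single R) = Q := by
  rw [Qual.subst_rename]
  exact Qual.subst_var Q

theorem Ty.instTy_rename {k : Kind} (T : Ty k) (S : STy) (ρ ξ : ℕ → ℕ) :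
    (T.instTy S).rename ρ ξ = (T.rename (liftRen ρ) ξ).instTy (S.rename ρ ξ) := by
  simp only [Ty.instTy, Ty.rename_subst, Ty.subst_rename]
  congr 1
  funext n; cases n <;> rfl

theorem Ty.instQual_rename {k : Kind} (T : Ty k) (Q : Qual) (ρ ξ : ℕ → ℕ) :
    (T.instQual Q).rename ρ ξ = (T.rename ρ (liftRen ξ)).instQual (Q.rename ξ) := by
  simp only [Ty.instQual, Ty.rename_subst, Ty.subst_rename]
  congr 1
  funext n; cases n <;> rfl

theorem Ty.instTy_subst {k : Kind} (T : Ty k) (S : STy) (τ : ℕ → STy) (θ : ℕ → Qual) :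
    (T.instTy S).subst τ θ = (T.subst (Ty.lift τ) θ).instTy (S.subst τ θ) := by
  simp only [Ty.instTy, Ty.subst_subst, Qual.subst_var]
  congr 1
  funext n
  cases n with
  | zero => rfl
  | succ n => exact (Ty.shiftTy_instTy _ _).symm

theorem Ty.instQual_subst {k : Kind} (T : Ty k) (Q : Qual) (τ : ℕ → STy) (θ : ℕ → Qual) :
    (T.instQual Q).subst τ θ
      = (T.subst (fun n => (τ n).shiftQual) (Qual.lift θ)).instQual (Q.subst θ) := by
  simp only [Ty.instQual, Ty.subst_subst]
  congr 1
  · funext n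
    exact (Ty.shiftQual_instQual _ _).symm
  · funext n
    cases n with
    | zero => rfl
    | succ n => exact (Qual.rename_succ_subst_single _ _).symm

/-! ### Well-formedness under renaming and substitution -/

/-- The variables bound in `Γ` are sent to variables bound in `Δ`. -/
structure DomRen (Δ Γ : Env) (ρ ξ : ℕ → ℕ) : Prop where
  ty : ∀ {X S}, HasTy Γ X S → ∃ S', HasTy Δ (ρ X) S'
  qu : ∀ {Y Q}, HasQu Γ Y Q → ∃ Q', HasQu Δ (ξ Y) Q'

theorem DomRen.consTy {Δ Γ : Env} {ρ ξ : ℕ → ℕ} (h : DomRen Δ Γ ρ ξ) (S S' : STy) :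
    DomRen (.ty S' :: Δ) (.ty S :: Γ) (liftRen ρ) ξ where
  ty := by
    rintro X U (_ | _ | ⟨_, _, X, U, hU⟩)
    · exact ⟨_, .here _ _⟩
    · obtain ⟨U', hU'⟩ := h.ty hU
      exact ⟨_, .ty _ _ _ _ hU'⟩
  qu := by
    rintro Y Q (_ | _ | ⟨_, _, _, _, hQ⟩)
    obtain ⟨Q', hQ'⟩ := h.qu hQ
    exact ⟨_, .ty _ _ _ _ hQ'⟩

theorem DomRen.consQu {Δ Γ : Env} {ρ ξ : ℕ → ℕ} (h : DomRen Δ Γ ρ ξ) (Q Q' : Qual) :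
    DomRen (.qu Q' :: Δ) (.qu Q :: Γ) ρ (liftRen ξ) where
  ty := by
    rintro X U (_ | _ | _ | ⟨_, _, X, U, hU⟩)
    obtain ⟨U', hU'⟩ := h.ty hU
    exact ⟨_, .qu _ _ _ _ hU'⟩
  qu := by
    rintro Y R (_ | _ | _ | ⟨_, _, Y, R, hR⟩)
    · exact ⟨_, .here _ _⟩
    · obtain ⟨R', hR'⟩ := h.qu hR
      exact ⟨_, .qu _ _ _ _ hR'⟩

theorem WfQual.rename {Δ Γ : Env} {ρ ξ : ℕ → ℕ} {Q : Qual} (hQ : WfQual Γ Q)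
    (h : DomRen Δ Γ ρ ξ) : WfQual Δ (Q.rename ξ) := by
  induction hQ with
  | top => exact .top
  | bot => exact .bot
  | var Y Q hY => obtain ⟨Q', hQ'⟩ := h.qu hY; exact .var _ _ hQ'
  | meet _ _ _ _ ih₁ ih₂ => exact .meet _ _ ih₁ ih₂
  | join _ _ _ _ ih₁ ih₂ => exact .join _ _ ih₁ ih₂

theorem WfTy.rename {k : Kind} {Δ Γ : Env} {ρ ξ : ℕ → ℕ} {T : Ty k} (hT : WfTy Γ T)
    (h : DomRen Δ Γ ρ ξ) : WfTy Δ (T.rename ρ ξ) := by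
  induction hT generalizing Δ ρ ξ with
  | top => exact .top _
  | var Γ X S hX => obtain ⟨S', hS'⟩ := h.ty hX; exact .var _ _ _ hS'
  | arrow _ _ _ _ _ ih₁ ih₂ => exact .arrow _ _ _ (ih₁ h) (ih₂ h)
  | all _ _ _ _ _ ih₁ ih₂ => exact .all _ _ _ (ih₁ h) (ih₂ (h.consTy _ _))
  | qall _ _ _ hQ _ ih => exact .qall _ _ _ (hQ.rename h) (ih (h.consQu _ _))
  | qual _ _ _ hQ _ ih => exact .qual _ _ _ (hQ.rename h) (ih h)

theorem DomRen.shiftTy (Γ : Env) (S : STy) : DomRen (.ty S :: Γ) Γ Nat.succ id where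
  ty h := ⟨_, .ty _ _ _ _ h⟩
  qu h := ⟨_, .ty _ _ _ _ h⟩

theorem DomRen.shiftQual (Γ : Env) (Q : Qual) : DomRen (.qu Q :: Γ) Γ id Nat.succ where
  ty h := ⟨_, .qu _ _ _ _ h⟩
  qu h := ⟨_, .qu _ _ _ _ h⟩

theorem DomRen.consTm (Γ : Env) (T : QTy) : DomRen (.tm T :: Γ) Γ id id where
  ty h := ⟨_, .tm _ _ _ _ h⟩
  qu h := ⟨_, .tm _ _ _ _ h⟩

theorem DomRen.dropTm (Γ : Env) (T : QTy) : DomRen Γ (.tm T :: Γ) id id where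
  ty := by rintro X S (_ | ⟨_, _, _, _, h⟩); exact ⟨_, h⟩
  qu := by rintro X S (_ | ⟨_, _, _, _, h⟩); exact ⟨_, h⟩

theorem DomRen.id (Γ : Env) : DomRen Γ Γ id id where
  ty h := ⟨_, h⟩
  qu h := ⟨_, h⟩

theorem WfQual.shiftTy {Γ : Env} {Q : Qual} (h : WfQual Γ Q) (S : STy) :
    WfQual (.ty S :: Γ) Q := by
  simpa only [Qual.rename_id] using h.rename (DomRen.shiftTy Γ S)

theorem WfQual.consTm {Γ : Env} {Q : Qual} (h : WfQual Γ Q) (T : QTy) :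
    WfQual (.tm T :: Γ) Q := by
  simpa only [Qual.rename_id] using h.rename (DomRen.consTm Γ T)

theorem WfTy.consTm {k : Kind} {Γ : Env} {U : Ty k} (h : WfTy Γ U) (T : QTy) :
    WfTy (.tm T :: Γ) U := by
  simpa only [Ty.rename_id] using h.rename (DomRen.consTm Γ T)

theorem WfTy.dropTm {k : Kind} {Γ : Env} {U : Ty k} {T : QTy} (h : WfTy (.tm T :: Γ) U) :
    WfTy Γ U := by
  simpa only [Ty.rename_id] using h.rename (DomRen.dropTm Γ T)

/-- Well-formedness of a type does not depend on the bound of a type variable. -/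
theorem WfTy.changeTy {k : Kind} {Γ : Env} {U : Ty k} {S : STy} (h : WfTy (.ty S :: Γ) U)
    (S' : STy) : WfTy (.ty S' :: Γ) U := by
  simpa only [liftRen_id, Ty.rename_id] using h.rename ((DomRen.id Γ).consTy S S')

/-- Well-formedness of a type does not depend on the bound of a qualifier variable. -/
theorem WfTy.changeQu {k : Kind} {Γ : Env} {U : Ty k} {Q : Qual} (h : WfTy (.qu Q :: Γ) U)
    (Q' : Qual) : WfTy (.qu Q' :: Γ) U := by
  simpa only [liftRen_id, Ty.rename_id] using h.rename ((DomRen.id Γ).consQu Q Q')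

/-- The variables bound in `Γ` are sent to types and qualifiers that are well-formed in `Δ`. -/
structure WfSubst (Δ Γ : Env) (τ : ℕ → STy) (θ : ℕ → Qual) : Prop where
  ty : ∀ {X S}, HasTy Γ X S → WfTy Δ (τ X)
  qu : ∀ {Y Q}, HasQu Γ Y Q → WfQual Δ (θ Y)

theorem WfSubst.consTy {Δ Γ : Env} {τ : ℕ → STy} {θ : ℕ → Qual} (h : WfSubst Δ Γ τ θ)
    (S S' : STy) : WfSubst (.ty S' :: Δ) (.ty S :: Γ) (Ty.lift τ) θ where
  ty := by
    rintro X U (_ | _ | ⟨_, _, X, U, hU⟩)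
    · exact .var _ _ _ (.here _ _)
    · exact (h.ty hU).rename (.shiftTy _ _)
  qu := by
    rintro Y Q (_ | _ | ⟨_, _, _, _, hQ⟩)
    exact (h.qu hQ).shiftTy _

theorem WfSubst.consQu {Δ Γ : Env} {τ : ℕ → STy} {θ : ℕ → Qual} (h : WfSubst Δ Γ τ θ)
    (Q Q' : Qual) :
    WfSubst (.qu Q' :: Δ) (.qu Q :: Γ) (fun n => (τ n).shiftQual) (Qual.lift θ) where
  ty := by
    rintro X U (_ | _ | _ | ⟨_, _, X, U, hU⟩)
    exact (h.ty hU).rename (.shiftQual _ _)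
  qu := by
    rintro Y R (_ | _ | _ | ⟨_, _, Y, R, hR⟩)
    · exact .var _ _ (.here _ _)
    · exact (h.qu hR).rename (.shiftQual _ _)

theorem WfQual.subst {Δ Γ : Env} {τ : ℕ → STy} {θ : ℕ → Qual} {Q : Qual} (hQ : WfQual Γ Q)
    (h : WfSubst Δ Γ τ θ) : WfQual Δ (Q.subst θ) := by
  induction hQ with
  | top => exact .top
  | bot => exact .bot
  | var Y Q hY => exact h.qu hY
  | meet _ _ _ _ ih₁ ih₂ => exact .meet _ _ ih₁ ih₂
  | join _ _ _ _ ih₁ ih₂ => exact .join _ _ ih₁ ih₂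

theorem WfTy.subst {k : Kind} {Δ Γ : Env} {τ : ℕ → STy} {θ : ℕ → Qual} {T : Ty k}
    (hT : WfTy Γ T) (h : WfSubst Δ Γ τ θ) : WfTy Δ (T.subst τ θ) := by
  induction hT generalizing Δ τ θ with
  | top => exact .top _
  | var Γ X S hX => exact h.ty hX
  | arrow _ _ _ _ _ ih₁ ih₂ => exact .arrow _ _ _ (ih₁ h) (ih₂ h)
  | all _ _ _ _ _ ih₁ ih₂ => exact .all _ _ _ (ih₁ h) (ih₂ (h.consTy _ _))
  | qall _ _ _ hQ _ ih => exact .qall _ _ _ (hQ.subst h) (ih (h.consQu _ _))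
  | qual _ _ _ hQ _ ih => exact .qual _ _ _ (hQ.subst h) (ih h)

theorem WfTy.instTy {Γ : Env} {S S' : STy} {T : QTy} (hT : WfTy (.ty S :: Γ) T)
    (hS : WfTy Γ S') : WfTy Γ (T.instTy S') := by
  refine hT.subst ⟨?_, ?_⟩
  · rintro X U (_ | _ | ⟨_, _, X, U, hU⟩)
    · exact hS
    · exact .var _ _ _ hU
  · rintro Y Q (_ | _ | ⟨_, _, _, _, hQ⟩)
    exact .var _ _ hQ

theorem WfTy.instQual {Γ : Env} {Q Q' : Qual} {T : QTy} (hT : WfTy (.qu Q :: Γ) T)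
    (hQ : WfQual Γ Q') : WfTy Γ (T.instQual Q') := by
  refine hT.subst ⟨?_, ?_⟩
  · rintro X U (_ | _ | _ | ⟨_, _, X, U, hU⟩)
    exact .var _ _ _ hU
  · rintro Y R (_ | _ | _ | ⟨_, _, Y, R, hR⟩)
    · exact hQ
    · exact .var _ _ hR

theorem HasTm.wf {Γ : Env} {x : ℕ} {T : QTy} (h : HasTm Γ x T) (hΓ : WfEnv Γ) : WfTy Γ T := by
  induction h with
  | here => cases hΓ with | tm _ _ _ h => exact h.consTm _
  | tm _ _ _ _ _ ih => cases hΓ with | tm _ _ h _ => exact (ih h).consTm _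
  | ty _ _ _ _ _ ih => cases hΓ with | ty _ _ h _ => exact (ih h).rename (.shiftTy _ _)
  | qu _ _ _ _ _ ih => cases hΓ with | qu _ _ h _ => exact (ih h).rename (.shiftQual _ _)

theorem HasQu.wf {Γ : Env} {Y : ℕ} {Q : Qual} (h : HasQu Γ Y Q) (hΓ : WfEnv Γ) : WfQual Γ Q := by
  induction h with
  | here => cases hΓ with | qu _ _ _ h => exact h.rename (.shiftQual _ _)
  | tm _ _ _ _ _ ih => cases hΓ with | tm _ _ h _ => exact (ih h).consTm _
  | ty _ _ _ _ _ ih => cases hΓ with | ty _ _ h _ => exact (ih h).shiftTy _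
  | qu _ _ _ _ _ ih => cases hΓ with | qu _ _ h _ => exact (ih h).rename (.shiftQual _ _)

/-! ### Renamings that respect the bounds -/

/-- The type and qualifier bindings of `Γ` are sent to bindings of `Δ` with the same bounds. -/
structure BoundRen (Δ Γ : Env) (ρ ξ : ℕ → ℕ) : Prop where
  ty : ∀ {X S}, HasTy Γ X S → HasTy Δ (ρ X) (S.rename ρ ξ)
  qu : ∀ {Y Q}, HasQu Γ Y Q → HasQu Δ (ξ Y) (Q.rename ξ)

theorem BoundRen.dom {Δ Γ : Env} {ρ ξ : ℕ → ℕ} (h : BoundRen Δ Γ ρ ξ) : DomRen Δ Γ ρ ξ where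
  ty hX := ⟨_, h.ty hX⟩
  qu hY := ⟨_, h.qu hY⟩

theorem BoundRen.consTm {Δ Γ : Env} {ρ ξ : ℕ → ℕ} (h : BoundRen Δ Γ ρ ξ) (T T' : QTy) :
    BoundRen (.tm T' :: Δ) (.tm T :: Γ) ρ ξ where
  ty := by rintro X U (_ | ⟨_, _, _, _, hU⟩); exact .tm _ _ _ _ (h.ty hU)
  qu := by rintro X U (_ | ⟨_, _, _, _, hU⟩); exact .tm _ _ _ _ (h.qu hU)

theorem BoundRen.consTy {Δ Γ : Env} {ρ ξ : ℕ → ℕ} (h : BoundRen Δ Γ ρ ξ) (S : STy) :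
    BoundRen (.ty (S.rename ρ ξ) :: Δ) (.ty S :: Γ) (liftRen ρ) ξ where
  ty := by
    rintro X U (_ | _ | ⟨_, _, X, U, hU⟩)
    · rw [Ty.shiftTy_rename]; exact .here _ _
    · rw [Ty.shiftTy_rename]; exact .ty _ _ _ _ (h.ty hU)
  qu := by
    rintro Y Q (_ | _ | ⟨_, _, _, _, hQ⟩)
    exact .ty _ _ _ _ (h.qu hQ)

theorem Qual.rename_succ_rename (Q : Qual) (ξ : ℕ → ℕ) :
    (Q.rename Nat.succ).rename (liftRen ξ) = (Q.rename ξ).rename Nat.succ := by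
  simp only [Qual.rename_rename]; rfl

theorem BoundRen.consQu {Δ Γ : Env} {ρ ξ : ℕ → ℕ} (h : BoundRen Δ Γ ρ ξ) (Q : Qual) :
    BoundRen (.qu (Q.rename ξ) :: Δ) (.qu Q :: Γ) ρ (liftRen ξ) where
  ty := by
    rintro X U (_ | _ | _ | ⟨_, _, X, U, hU⟩)
    rw [Ty.shiftQual_rename]; exact .qu _ _ _ _ (h.ty hU)
  qu := by
    rintro Y R (_ | _ | _ | ⟨_, _, Y, R, hR⟩)
    · rw [Qual.rename_succ_rename]; exact .here _ _
    · rw [Qual.rename_succ_rename]; exact .qu _ _ _ _ (h.qu hR)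

theorem BoundRen.shiftTm (Γ : Env) (T : QTy) : BoundRen (.tm T :: Γ) Γ id id where
  ty h := by rw [Ty.rename_id]; exact .tm _ _ _ _ h
  qu h := by rw [Qual.rename_id]; exact .tm _ _ _ _ h

theorem BoundRen.shiftTy (Γ : Env) (S : STy) : BoundRen (.ty S :: Γ) Γ Nat.succ id where
  ty h := .ty _ _ _ _ h
  qu h := by rw [Qual.rename_id]; exact .ty _ _ _ _ h

theorem BoundRen.shiftQual (Γ : Env) (Q : Qual) : BoundRen (.qu Q :: Γ) Γ id Nat.succ where
  ty h := .qu _ _ _ _ h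
  qu h := .qu _ _ _ _ h

/-! ### Subqualification -/

theorem SubQual.wf {Γ : Env} {Q R : Qual} (h : SubQual Γ Q R) :
    WfEnv Γ ∧ WfQual Γ Q ∧ WfQual Γ R := by
  induction h with
  | top _ h₁ h₂ => exact ⟨h₁, h₂, .top⟩
  | bot _ h₁ h₂ => exact ⟨h₁, .bot, h₂⟩
  | refl_var _ h₁ h₂ => exact ⟨h₁, h₂, h₂⟩
  | var _ _ _ hY _ ih => exact ⟨ih.1, .var _ _ hY, ih.2.2⟩
  | join_intro_1 _ _ _ _ hR ih => exact ⟨ih.1, ih.2.1, .join _ _ ih.2.2 hR⟩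
  | join_intro_2 _ _ _ hR _ ih => exact ⟨ih.1, ih.2.1, .join _ _ hR ih.2.2⟩
  | join_elim _ _ _ _ _ ih₁ ih₂ => exact ⟨ih₁.1, .join _ _ ih₁.2.1 ih₂.2.1, ih₁.2.2⟩
  | meet_elim_1 _ _ _ _ hQ ih => exact ⟨ih.1, .meet _ _ ih.2.1 hQ, ih.2.2⟩
  | meet_elim_2 _ _ _ hQ _ ih => exact ⟨ih.1, .meet _ _ hQ ih.2.1, ih.2.2⟩
  | meet_intro _ _ _ _ _ ih₁ ih₂ => exact ⟨ih₁.1, ih₁.2.1, .meet _ _ ih₁.2.2 ih₂.2.2⟩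

theorem SubQual.refl {Γ : Env} {Q : Qual} (hΓ : WfEnv Γ) (hQ : WfQual Γ Q) : SubQual Γ Q Q := by
  induction hQ with
  | top => exact .top _ hΓ .top
  | bot => exact .bot _ hΓ .bot
  | var Y Q hY => exact .refl_var _ hΓ (.var _ _ hY)
  | meet Q R hQ hR ih₁ ih₂ =>
    exact .meet_intro _ _ _ (.meet_elim_1 _ _ _ ih₁ hR) (.meet_elim_2 _ _ _ hQ ih₂)
  | join Q R hQ hR ih₁ ih₂ =>
    exact .join_elim _ _ _ (.join_intro_1 _ _ _ ih₁ hR) (.join_intro_2 _ _ _ hQ ih₂)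

theorem HasQu.subQual {Γ : Env} {Y : ℕ} {Q : Qual} (h : HasQu Γ Y Q) (hΓ : WfEnv Γ) :
    SubQual Γ (.var Y) Q :=
  .var _ _ _ h (.refl hΓ (h.wf hΓ))

theorem SubQual.rename {Δ Γ : Env} {ρ ξ : ℕ → ℕ} {Q R : Qual} (h : SubQual Γ Q R)
    (hΔ : WfEnv Δ) (hr : BoundRen Δ Γ ρ ξ) : SubQual Δ (Q.rename ξ) (R.rename ξ) := by
  induction h with
  | top _ _ h => exact .top _ hΔ (h.rename hr.dom)
  | bot _ _ h => exact .bot _ hΔ (h.rename hr.dom)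
  | refl_var _ _ h => exact .refl_var _ hΔ (h.rename hr.dom)
  | var _ _ _ hY _ ih => exact .var _ _ _ (hr.qu hY) ih
  | join_intro_1 _ _ _ _ hR ih => exact .join_intro_1 _ _ _ ih (hR.rename hr.dom)
  | join_intro_2 _ _ _ hR _ ih => exact .join_intro_2 _ _ _ (hR.rename hr.dom) ih
  | join_elim _ _ _ _ _ ih₁ ih₂ => exact .join_elim _ _ _ ih₁ ih₂
  | meet_elim_1 _ _ _ _ hQ ih => exact .meet_elim_1 _ _ _ ih (hQ.rename hr.dom)
  | meet_elim_2 _ _ _ hQ _ ih => exact .meet_elim_2 _ _ _ (hQ.rename hr.dom) ih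
  | meet_intro _ _ _ _ _ ih₁ ih₂ => exact .meet_intro _ _ _ ih₁ ih₂

theorem SubQual.of_top {Γ : Env} {P Q : Qual} (h : SubQual Γ .top P) (hQ : WfQual Γ Q) :
    SubQual Γ Q P := by
  generalize hT : Qual.top = R at h
  induction h with
  | top _ hΓ _ => exact .top _ hΓ hQ
  | join_intro_1 _ _ _ _ hR ih => exact .join_intro_1 _ _ _ (ih hT) hR
  | join_intro_2 _ _ _ hR _ ih => exact .join_intro_2 _ _ _ hR (ih hT)
  | meet_intro _ _ _ _ _ ih₁ ih₂ => exact .meet_intro _ _ _ (ih₁ hT) (ih₂ hT)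
  | _ => cases hT

theorem SubQual.of_join {Γ : Env} {P Q R : Qual} (h : SubQual Γ (.join Q R) P) :
    SubQual Γ Q P ∧ SubQual Γ R P := by
  generalize hJ : Qual.join Q R = J at h
  induction h with
  | top _ hΓ h =>
    subst hJ
    cases h with | join _ _ h₁ h₂ => exact ⟨.top _ hΓ h₁, .top _ hΓ h₂⟩
  | join_intro_1 _ _ _ _ hR ih =>
    exact ⟨.join_intro_1 _ _ _ (ih hJ).1 hR, .join_intro_1 _ _ _ (ih hJ).2 hR⟩
  | join_intro_2 _ _ _ hR _ ih =>
    exact ⟨.join_intro_2 _ _ _ hR (ih hJ).1, .join_intro_2 _ _ _ hR (ih hJ).2⟩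
  | meet_intro _ _ _ _ _ ih₁ ih₂ =>
    exact ⟨.meet_intro _ _ _ (ih₁ hJ).1 (ih₂ hJ).1, .meet_intro _ _ _ (ih₁ hJ).2 (ih₂ hJ).2⟩
  | join_elim _ _ _ h₁ h₂ _ _ => cases hJ; exact ⟨h₁, h₂⟩
  | _ => cases hJ

theorem SubQual.of_meet {Γ : Env} {P Q R₁ R₂ : Qual} (h : SubQual Γ (.meet R₁ R₂) P)
    (hQ : WfQual Γ Q) (h₁ : ∀ P, SubQual Γ R₁ P → SubQual Γ Q P)
    (h₂ : ∀ P, SubQual Γ R₂ P → SubQual Γ Q P) : SubQual Γ Q P := by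
  generalize hM : Qual.meet R₁ R₂ = M at h
  induction h with
  | top _ hΓ _ => exact .top _ hΓ hQ
  | join_intro_1 _ _ _ _ hR ih => exact .join_intro_1 _ _ _ (ih hM) hR
  | join_intro_2 _ _ _ hR _ ih => exact .join_intro_2 _ _ _ hR (ih hM)
  | meet_intro _ _ _ _ _ ih₁ ih₂ => exact .meet_intro _ _ _ (ih₁ hM) (ih₂ hM)
  | meet_elim_1 _ _ _ h _ _ => cases hM; exact h₁ _ h
  | meet_elim_2 _ _ _ _ h _ => cases hM; exact h₂ _ h
  | _ => cases hM

theorem SubQual.trans {Γ : Env} {P Q R : Qual} (h : SubQual Γ Q R) (h' : SubQual Γ R P) :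
    SubQual Γ Q P := by
  induction h generalizing P with
  | top _ _ hQ => exact h'.of_top hQ
  | bot _ hΓ _ => exact .bot _ hΓ h'.wf.2.2
  | refl_var _ _ _ => exact h'
  | var _ _ _ hY _ ih => exact .var _ _ _ hY (ih h')
  | join_intro_1 _ _ _ _ _ ih => exact ih h'.of_join.1
  | join_intro_2 _ _ _ _ _ ih => exact ih h'.of_join.2
  | join_elim _ _ _ _ _ ih₁ ih₂ => exact .join_elim _ _ _ (ih₁ h') (ih₂ h')
  | meet_elim_1 _ _ _ _ hQ ih => exact .meet_elim_1 _ _ _ (ih h') hQ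
  | meet_elim_2 _ _ _ hQ _ ih => exact .meet_elim_2 _ _ _ hQ (ih h')
  | meet_intro _ _ _ h _ ih₁ ih₂ => exact h'.of_meet h.wf.2.1 (fun _ => ih₁) (fun _ => ih₂)

/-! ### Subtyping: regularity, reflexivity, renaming -/

theorem WfEnv.ty_inv {Γ : Env} {S : STy} (h : WfEnv (.ty S :: Γ)) : WfEnv Γ ∧ WfTy Γ S := by
  cases h with | ty _ _ h₁ h₂ => exact ⟨h₁, h₂⟩

theorem WfEnv.qu_inv {Γ : Env} {Q : Qual} (h : WfEnv (.qu Q :: Γ)) : WfEnv Γ ∧ WfQual Γ Q := by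
  cases h with | qu _ _ h₁ h₂ => exact ⟨h₁, h₂⟩

theorem WfEnv.tm_inv {Γ : Env} {T : QTy} (h : WfEnv (.tm T :: Γ)) : WfEnv Γ ∧ WfTy Γ T := by
  cases h with | tm _ _ h₁ h₂ => exact ⟨h₁, h₂⟩

theorem Sub.wf {k : Kind} {Γ : Env} {A B : Ty k} (h : Sub Γ A B) :
    WfEnv Γ ∧ WfTy Γ A ∧ WfTy Γ B := by
  induction h with
  | top _ _ h₁ h₂ => exact ⟨h₁, h₂, .top _⟩
  | refl_var _ _ h₁ h₂ => exact ⟨h₁, h₂, h₂⟩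
  | var _ _ _ _ hX _ ih => exact ⟨ih.1, .var _ _ _ hX, ih.2.2⟩
  | arrow _ _ _ _ _ _ _ ih₁ ih₂ =>
    exact ⟨ih₁.1, .arrow _ _ _ ih₁.2.2 ih₂.2.1, .arrow _ _ _ ih₁.2.1 ih₂.2.2⟩
  | all _ _ _ _ _ _ _ ih₁ ih₂ =>
    exact ⟨ih₁.1, .all _ _ _ ih₁.2.2 (ih₂.2.1.changeTy _), .all _ _ _ ih₁.2.1 ih₂.2.2⟩
  | qall _ _ _ _ _ hQ _ ih =>
    exact ⟨hQ.wf.1, .qall _ _ _ hQ.wf.2.2 (ih.2.1.changeQu _), .qall _ _ _ hQ.wf.2.1 ih.2.2⟩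
  | qtype _ _ _ _ _ hQ _ ih =>
    exact ⟨ih.1, .qual _ _ _ hQ.wf.2.1 ih.2.1, .qual _ _ _ hQ.wf.2.2 ih.2.2⟩

theorem Sub.refl {k : Kind} {Γ : Env} {T : Ty k} (hΓ : WfEnv Γ) (hT : WfTy Γ T) :
    Sub Γ T T := by
  induction hT with
  | top => exact .top _ _ hΓ (.top _)
  | var Γ X S hX => exact .refl_var _ _ hΓ (.var _ _ _ hX)
  | arrow _ _ _ _ _ ih₁ ih₂ => exact .arrow _ _ _ _ _ (ih₁ hΓ) (ih₂ hΓ)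
  | all _ _ _ hS _ ih₁ ih₂ => exact .all _ _ _ _ _ (ih₁ hΓ) (ih₂ (.ty _ _ hΓ hS))
  | qall _ _ _ hQ _ ih => exact .qall _ _ _ _ _ (.refl hΓ hQ) (ih (.qu _ _ hΓ hQ))
  | qual _ _ _ hQ _ ih => exact .qtype _ _ _ _ _ (.refl hΓ hQ) (ih hΓ)

theorem Sub.rename {k : Kind} {Δ Γ : Env} {ρ ξ : ℕ → ℕ} {A B : Ty k} (h : Sub Γ A B)
    (hΔ : WfEnv Δ) (hr : BoundRen Δ Γ ρ ξ) : Sub Δ (A.rename ρ ξ) (B.rename ρ ξ) := by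
  induction h generalizing Δ ρ ξ with
  | top _ _ _ h => exact .top _ _ hΔ (h.rename hr.dom)
  | refl_var _ _ _ h => exact .refl_var _ _ hΔ (h.rename hr.dom)
  | var _ _ _ _ hX _ ih => exact .var _ _ _ _ (hr.ty hX) (ih hΔ hr)
  | arrow _ _ _ _ _ _ _ ih₁ ih₂ => exact .arrow _ _ _ _ _ (ih₁ hΔ hr) (ih₂ hΔ hr)
  | all _ _ _ _ _ _ _ ih₁ ih₂ =>
    have h := ih₁ hΔ hr
    exact .all _ _ _ _ _ h (ih₂ (.ty _ _ hΔ h.wf.2.1) (hr.consTy _))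
  | qall _ _ _ _ _ hQ _ ih =>
    have h := hQ.rename hΔ hr
    exact .qall _ _ _ _ _ h (ih (.qu _ _ hΔ h.wf.2.1) (hr.consQu _))
  | qtype _ _ _ _ _ hQ _ ih => exact .qtype _ _ _ _ _ (hQ.rename hΔ hr) (ih hΔ hr)

/-! ### Subtyping: substitution, narrowing and transitivity -/

/-- The number of type constructors of a type. -/
def Ty.size : {k : Kind} → Ty k → ℕ
  | _, .top => 1
  | _, .var _ => 1
  | _, .arrow T₁ T₂ => T₁.size + T₂.size + 1
  | _, .all S T => S.size + T.size + 1
  | _, .qall _ T => T.size + 1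
  | _, .qual _ S => S.size + 1

theorem Ty.size_rename {k : Kind} (T : Ty k) (ρ ξ : ℕ → ℕ) : (T.rename ρ ξ).size = T.size := by
  induction T generalizing ρ ξ <;> simp_all [Ty.size, Ty.rename]

/-- Transitivity of subtyping through middle types of size `n`. -/
def TransAt (n : ℕ) : Prop :=
  ∀ {k : Kind} {Γ : Env} {A B C : Ty k}, B.size = n → Sub Γ A B → Sub Γ B C → Sub Γ A C

/-- A substitution that respects the bounds of `Γ`.  A type variable is sent to a type variable
with the corresponding bound, or to a subtype of a bound through which subtyping is known to be
transitive. -/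
structure BoundSubst (Δ Γ : Env) (τ : ℕ → STy) (θ : ℕ → Qual) : Prop where
  ty : ∀ {X S}, HasTy Γ X S →
    (∃ X', τ X = .var X' ∧ HasTy Δ X' (S.subst τ θ)) ∨
      TransAt (S.subst τ θ).size ∧ Sub Δ (τ X) (S.subst τ θ)
  qu : ∀ {Y Q}, HasQu Γ Y Q → SubQual Δ (θ Y) (Q.subst θ)

theorem BoundSubst.wf {Δ Γ : Env} {τ : ℕ → STy} {θ : ℕ → Qual} (h : BoundSubst Δ Γ τ θ) :
    WfSubst Δ Γ τ θ where
  ty hX := by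
    obtain ⟨X', e, hX'⟩ | ⟨-, hs⟩ := h.ty hX
    · rw [e]; exact .var _ _ _ hX'
    · exact hs.wf.2.1
  qu hY := (h.qu hY).wf.2.1

theorem BoundSubst.consTm {Δ Γ : Env} {τ : ℕ → STy} {θ : ℕ → Qual} (h : BoundSubst Δ Γ τ θ)
    {T : QTy} (T' : QTy) (hΔ : WfEnv (.tm T :: Δ)) :
    BoundSubst (.tm T :: Δ) (.tm T' :: Γ) τ θ where
  ty := by
    rintro X U (_ | ⟨_, _, _, _, hU⟩)
    obtain ⟨X', e, hX'⟩ | ⟨ht, hs⟩ := h.ty hU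
    · exact .inl ⟨X', e, .tm _ _ _ _ hX'⟩
    · exact .inr ⟨ht, by simpa only [Ty.rename_id] using hs.rename hΔ (.shiftTm _ _)⟩
  qu := by
    rintro Y Q (_ | ⟨_, _, _, _, hQ⟩)
    simpa only [Qual.rename_id] using (h.qu hQ).rename hΔ (.shiftTm _ _)

theorem BoundSubst.consTy {Δ Γ : Env} {τ : ℕ → STy} {θ : ℕ → Qual} (h : BoundSubst Δ Γ τ θ)
    {S : STy} (hΔ : WfEnv (.ty (S.subst τ θ) :: Δ)) :
    BoundSubst (.ty (S.subst τ θ) :: Δ) (.ty S :: Γ) (Ty.lift τ) θ where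
  ty := by
    rintro X U (_ | _ | ⟨_, _, X, U, hU⟩)
    · exact .inl ⟨0, rfl, by rw [Ty.shiftTy_subst]; exact .here _ _⟩
    · rw [Ty.shiftTy_subst]
      obtain ⟨X', e, hX'⟩ | ⟨ht, hs⟩ := h.ty hU
      · exact .inl ⟨X' + 1, by simp only [Ty.lift, e]; rfl, .ty _ _ _ _ hX'⟩
      · exact .inr ⟨by rw [Ty.shiftTy, Ty.size_rename]; exact ht, hs.rename hΔ (.shiftTy _ _)⟩
  qu := by
    rintro Y Q (_ | _ | ⟨_, _, _, _, hQ⟩)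
    simpa only [Qual.rename_id] using (h.qu hQ).rename hΔ (.shiftTy _ _)

theorem Qual.rename_succ_subst_lift (Q : Qual) (θ : ℕ → Qual) :
    (Q.rename Nat.succ).subst (Qual.lift θ) = (Q.subst θ).rename Nat.succ := by
  simp only [Qual.subst_rename, Qual.rename_subst]; rfl

theorem BoundSubst.consQu {Δ Γ : Env} {τ : ℕ → STy} {θ : ℕ → Qual} (h : BoundSubst Δ Γ τ θ)
    {Q : Qual} (hΔ : WfEnv (.qu (Q.subst θ) :: Δ)) :
    BoundSubst (.qu (Q.subst θ) :: Δ) (.qu Q :: Γ) (fun n => (τ n).shiftQual) (Qual.lift θ) where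
  ty := by
    rintro X U (_ | _ | _ | ⟨_, _, X, U, hU⟩)
    rw [Ty.shiftQual_subst]
    obtain ⟨X', e, hX'⟩ | ⟨ht, hs⟩ := h.ty hU
    · exact .inl ⟨X', by simp only [e]; rfl, .qu _ _ _ _ hX'⟩
    · exact .inr ⟨by rw [Ty.shiftQual, Ty.size_rename]; exact ht, hs.rename hΔ (.shiftQual _ _)⟩
  qu := by
    rintro Y R (_ | _ | _ | ⟨_, _, Y, R, hR⟩)
    · rw [Qual.rename_succ_subst_lift]
      exact (HasQu.here _ _).subQual hΔ
    · rw [Qual.rename_succ_subst_lift]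
      exact (h.qu hR).rename hΔ (.shiftQual _ _)

theorem SubQual.subst {Δ Γ : Env} {τ : ℕ → STy} {θ : ℕ → Qual} {Q R : Qual} (h : SubQual Γ Q R)
    (hΔ : WfEnv Δ) (hs : BoundSubst Δ Γ τ θ) : SubQual Δ (Q.subst θ) (R.subst θ) := by
  induction h with
  | top _ _ h => exact .top _ hΔ (h.subst hs.wf)
  | bot _ _ h => exact .bot _ hΔ (h.subst hs.wf)
  | refl_var _ _ h => exact .refl hΔ (h.subst hs.wf)
  | var _ _ _ hY _ ih => exact (hs.qu hY).trans ih
  | join_intro_1 _ _ _ _ hR ih => exact .join_intro_1 _ _ _ ih (hR.subst hs.wf)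
  | join_intro_2 _ _ _ hR _ ih => exact .join_intro_2 _ _ _ (hR.subst hs.wf) ih
  | join_elim _ _ _ _ _ ih₁ ih₂ => exact .join_elim _ _ _ ih₁ ih₂
  | meet_elim_1 _ _ _ _ hQ ih => exact .meet_elim_1 _ _ _ ih (hQ.subst hs.wf)
  | meet_elim_2 _ _ _ hQ _ ih => exact .meet_elim_2 _ _ _ (hQ.subst hs.wf) ih
  | meet_intro _ _ _ _ _ ih₁ ih₂ => exact .meet_intro _ _ _ ih₁ ih₂

theorem Sub.subst {k : Kind} {Δ Γ : Env} {τ : ℕ → STy} {θ : ℕ → Qual} {A B : Ty k}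
    (h : Sub Γ A B) (hΔ : WfEnv Δ) (hs : BoundSubst Δ Γ τ θ) :
    Sub Δ (A.subst τ θ) (B.subst τ θ) := by
  induction h generalizing Δ τ θ with
  | top _ _ _ h => exact .top _ _ hΔ (h.subst hs.wf)
  | refl_var _ _ _ h => exact .refl hΔ (h.subst hs.wf)
  | var _ X _ _ hX _ ih =>
    obtain ⟨X', e, hX'⟩ | ⟨ht, hb⟩ := hs.ty hX
    · rw [show Ty.subst τ θ (.var X) = τ X from rfl, e]
      exact .var _ _ _ _ hX' (ih hΔ hs)
    · exact ht rfl hb (ih hΔ hs)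
  | arrow _ _ _ _ _ _ _ ih₁ ih₂ => exact .arrow _ _ _ _ _ (ih₁ hΔ hs) (ih₂ hΔ hs)
  | all _ _ _ _ _ _ _ ih₁ ih₂ =>
    have h := ih₁ hΔ hs
    have hΔ' := WfEnv.ty _ _ hΔ h.wf.2.1
    exact .all _ _ _ _ _ h (ih₂ hΔ' (hs.consTy hΔ'))
  | qall _ _ _ _ _ hQ _ ih =>
    have h := hQ.subst hΔ hs
    have hΔ' := WfEnv.qu _ _ hΔ h.wf.2.1
    exact .qall _ _ _ _ _ h (ih hΔ' (hs.consQu hΔ'))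
  | qtype _ _ _ _ _ hQ _ ih => exact .qtype _ _ _ _ _ (hQ.subst hΔ hs) (ih hΔ hs)

theorem Sub.narrowTy {k : Kind} {Γ : Env} {S S' : STy} {A B : Ty k}
    (h : Sub (.ty S :: Γ) A B) (hS : Sub Γ S' S) (ht : TransAt S.size) :
    Sub (.ty S' :: Γ) A B := by
  have hΔ := WfEnv.ty _ _ hS.wf.1 hS.wf.2.1
  have hb : BoundSubst (.ty S' :: Γ) (.ty S :: Γ) .var .var := by
    refine ⟨?_, ?_⟩
    · rintro X U (_ | _ | ⟨_, _, X, U, hU⟩)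
      · rw [Ty.subst_var]
        refine .inr ⟨by rw [Ty.shiftTy, Ty.size_rename]; exact ht, ?_⟩
        exact .var _ _ _ _ (.here _ _) (hS.rename hΔ (.shiftTy _ _))
      · rw [Ty.subst_var]
        exact .inl ⟨_, rfl, .ty _ _ _ _ hU⟩
    · rintro Y Q (_ | _ | ⟨_, _, _, _, hQ⟩)
      rw [Qual.subst_var]
      exact (HasQu.ty _ _ _ _ hQ).subQual hΔ
  simpa only [Ty.subst_var] using h.subst hΔ hb

theorem Sub.narrowQu {k : Kind} {Γ : Env} {Q Q' : Qual} {A B : Ty k}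
    (h : Sub (.qu Q :: Γ) A B) (hQ : SubQual Γ Q' Q) : Sub (.qu Q' :: Γ) A B := by
  have hΔ := WfEnv.qu _ _ hQ.wf.1 hQ.wf.2.1
  have hb : BoundSubst (.qu Q' :: Γ) (.qu Q :: Γ) .var .var := by
    refine ⟨?_, ?_⟩
    · rintro X U (_ | _ | _ | ⟨_, _, X, U, hU⟩)
      rw [Ty.subst_var]
      exact .inl ⟨_, rfl, .qu _ _ _ _ hU⟩
    · rintro Y R (_ | _ | _ | ⟨_, _, Y, R, hR⟩)
      · rw [Qual.subst_var]
        exact .var _ _ _ (.here _ _) (hQ.rename hΔ (.shiftQual _ _))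
      · rw [Qual.subst_var]
        exact (HasQu.qu _ _ _ _ hR).subQual hΔ
  simpa only [Ty.subst_var] using h.subst hΔ hb

theorem transAt (n : ℕ) : TransAt n := by
  induction n using Nat.strong_induction_on with
  | _ n ih =>
    intro k Γ A B C hn hAB hBC
    induction hAB with
    | top _ _ hΓ hS => cases hBC; exact .top _ _ hΓ hS
    | refl_var => exact hBC
    | var _ _ _ _ hX _ ih' => exact .var _ _ _ _ hX (ih' hn hBC)
    | arrow _ _ _ _ _ h₁ h₂ =>
      simp only [Ty.size] at hn
      cases hBC with
      | top _ _ hΓ _ => exact .top _ _ hΓ (.arrow _ _ _ h₁.wf.2.2 h₂.wf.2.1)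
      | arrow _ _ _ _ _ h₁' h₂' =>
        exact .arrow _ _ _ _ _ (ih _ (by omega) rfl h₁' h₁) (ih _ (by omega) rfl h₂ h₂')
    | all _ _ _ _ _ h₁ h₂ =>
      simp only [Ty.size] at hn
      cases hBC with
      | top _ _ hΓ _ => exact .top _ _ hΓ (Sub.all _ _ _ _ _ h₁ h₂).wf.2.1
      | all _ _ _ _ _ h₁' h₂' =>
        exact .all _ _ _ _ _ (ih _ (by omega) rfl h₁' h₁)
          (ih _ (by omega) rfl (h₂.narrowTy h₁' (ih _ (by omega))) h₂')
    | qall _ _ _ _ _ h₁ h₂ =>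
      simp only [Ty.size] at hn
      cases hBC with
      | top _ _ hΓ _ => exact .top _ _ hΓ (Sub.qall _ _ _ _ _ h₁ h₂).wf.2.1
      | qall _ _ _ _ _ h₁' h₂' =>
        exact .qall _ _ _ _ _ (h₁'.trans h₁) (ih _ (by omega) rfl (h₂.narrowQu h₁') h₂')
    | qtype _ _ _ _ _ h₁ h₂ =>
      simp only [Ty.size] at hn
      cases hBC with
      | qtype _ _ _ _ _ h₁' h₂' =>
        exact .qtype _ _ _ _ _ (h₁.trans h₁') (ih _ (by omega) rfl h₂ h₂')

theorem Sub.trans {k : Kind} {Γ : Env} {A B C : Ty k} (h₁ : Sub Γ A B) (h₂ : Sub Γ B C) :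
    Sub Γ A C :=
  transAt _ rfl h₁ h₂

theorem BoundSubst.id {Γ : Env} (hΓ : WfEnv Γ) : BoundSubst Γ Γ .var .var where
  ty hX := .inl ⟨_, rfl, by rw [Ty.subst_var]; exact hX⟩
  qu hY := by rw [Qual.subst_var]; exact hY.subQual hΓ

theorem BoundSubst.dropTm {Γ : Env} (hΓ : WfEnv Γ) (T : QTy) :
    BoundSubst Γ (.tm T :: Γ) .var .var where
  ty := by rintro X S (_ | ⟨_, _, _, _, h⟩); exact (BoundSubst.id hΓ).ty h
  qu := by rintro Y Q (_ | ⟨_, _, _, _, h⟩); exact (BoundSubst.id hΓ).qu h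

theorem BoundSubst.singleTy {Γ : Env} {S S' : STy} (h : Sub Γ S' S) :
    BoundSubst Γ (.ty S :: Γ) (.single S') .var where
  ty := by
    rintro X U (_ | _ | ⟨_, _, X, U, hU⟩)
    · rw [show Ty.subst _ _ (Ty.shiftTy S) = S from Ty.shiftTy_instTy S S']
      exact .inr ⟨transAt _, h⟩
    · rw [show Ty.subst _ _ (Ty.shiftTy U) = U from Ty.shiftTy_instTy U S']
      exact .inl ⟨_, rfl, hU⟩
  qu := by
    rintro Y Q (_ | _ | ⟨_, _, _, _, hQ⟩)
    exact (BoundSubst.id h.wf.1).qu hQ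

theorem BoundSubst.singleQual {Γ : Env} {Q Q' : Qual} (h : SubQual Γ Q' Q) :
    BoundSubst Γ (.qu Q :: Γ) .var (.single Q') where
  ty := by
    rintro X U (_ | _ | _ | ⟨_, _, X, U, hU⟩)
    rw [show Ty.subst _ _ (Ty.shiftQual U) = U from Ty.shiftQual_instQual U Q']
    exact .inl ⟨_, rfl, hU⟩
  qu := by
    rintro Y R (_ | _ | _ | ⟨_, _, Y, R, hR⟩)
    · rw [Qual.rename_succ_subst_single]; exact h
    · rw [Qual.rename_succ_subst_single]; exact hR.subQual h.wf.1

/-! ### Typing: regularity, renaming, substitution -/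

theorem Typing.wf {Γ : Env} {t : Tm} {T : QTy} (h : Typing Γ t T) : WfEnv Γ ∧ WfTy Γ T := by
  induction h with
  | var _ _ _ hΓ hx => exact ⟨hΓ, hx.wf hΓ⟩
  | abs _ _ _ _ _ hP _ ih =>
    exact ⟨ih.1.tm_inv.1, .qual _ _ _ hP (.arrow _ _ _ ih.1.tm_inv.2 ih.2.dropTm)⟩
  | t_abs _ _ _ _ _ hP _ ih =>
    exact ⟨ih.1.ty_inv.1, .qual _ _ _ hP (.all _ _ _ ih.1.ty_inv.2 ih.2)⟩
  | q_abs _ _ _ _ _ hP _ ih =>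
    exact ⟨ih.1.qu_inv.1, .qual _ _ _ hP (.qall _ _ _ ih.1.qu_inv.2 ih.2)⟩
  | app _ _ _ _ _ _ _ _ ih _ =>
    obtain ⟨hΓ, _ | _ | _ | _ | _ | ⟨_, _, _, _, _ | _ | ⟨_, _, _, _, h⟩⟩⟩ := ih
    exact ⟨hΓ, h⟩
  | t_app _ _ _ _ _ _ _ hS ih =>
    obtain ⟨hΓ, _ | _ | _ | _ | _ | ⟨_, _, _, _, _ | _ | _ | ⟨_, _, _, _, h⟩⟩⟩ := ih
    exact ⟨hΓ, h.instTy hS.wf.2.1⟩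
  | q_app _ _ _ _ _ _ _ hQ ih =>
    obtain ⟨hΓ, _ | _ | _ | _ | _ | ⟨_, _, _, _, _ | _ | _ | _ | ⟨_, _, _, _, h⟩⟩⟩ := ih
    exact ⟨hΓ, h.instQual hQ.wf.2.1⟩
  | typ_assert _ _ _ _ _ _ _ ih => exact ih
  | typ_upqual _ _ _ _ _ _ hQ ih =>
    obtain ⟨hΓ, _ | _ | _ | _ | _ | ⟨_, _, _, _, h⟩⟩ := ih
    exact ⟨hΓ, .qual _ _ _ hQ.wf.2.2 h⟩
  | sub _ _ _ _ _ hs _ => exact ⟨hs.wf.1, hs.wf.2.2⟩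

/-- The bindings of `Γ` are sent to bindings of `Δ` with the same bounds and types. -/
structure EnvRen (Δ Γ : Env) (χ ρ ξ : ℕ → ℕ) : Prop extends BoundRen Δ Γ ρ ξ where
  tm : ∀ {x T}, HasTm Γ x T → HasTm Δ (χ x) (T.rename ρ ξ)

theorem EnvRen.consTm {Δ Γ : Env} {χ ρ ξ : ℕ → ℕ} (h : EnvRen Δ Γ χ ρ ξ) (T : QTy) :
    EnvRen (.tm (T.rename ρ ξ) :: Δ) (.tm T :: Γ) (liftRen χ) ρ ξ where
  toBoundRen := h.toBoundRen.consTm _ _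
  tm := by
    rintro x U (_ | ⟨_, _, x, _, hU⟩)
    · exact .here _ _
    · exact .tm _ _ _ _ (h.tm hU)

theorem EnvRen.consTy {Δ Γ : Env} {χ ρ ξ : ℕ → ℕ} (h : EnvRen Δ Γ χ ρ ξ) (S : STy) :
    EnvRen (.ty (S.rename ρ ξ) :: Δ) (.ty S :: Γ) χ (liftRen ρ) ξ where
  toBoundRen := h.toBoundRen.consTy _
  tm := by
    rintro x U (_ | _ | ⟨_, _, x, U, hU⟩)
    rw [Ty.shiftTy_rename]; exact .ty _ _ _ _ (h.tm hU)

theorem EnvRen.consQu {Δ Γ : Env} {χ ρ ξ : ℕ → ℕ} (h : EnvRen Δ Γ χ ρ ξ) (Q : Qual) :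
    EnvRen (.qu (Q.rename ξ) :: Δ) (.qu Q :: Γ) χ ρ (liftRen ξ) where
  toBoundRen := h.toBoundRen.consQu _
  tm := by
    rintro x U (_ | _ | _ | ⟨_, _, x, U, hU⟩)
    rw [Ty.shiftQual_rename]; exact .qu _ _ _ _ (h.tm hU)

theorem EnvRen.shiftTm (Γ : Env) (T : QTy) : EnvRen (.tm T :: Γ) Γ Nat.succ id id where
  toBoundRen := .shiftTm _ _
  tm h := by rw [Ty.rename_id]; exact .tm _ _ _ _ h

theorem EnvRen.shiftTy (Γ : Env) (S : STy) : EnvRen (.ty S :: Γ) Γ id Nat.succ id where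
  toBoundRen := .shiftTy _ _
  tm h := .ty _ _ _ _ h

theorem EnvRen.shiftQual (Γ : Env) (Q : Qual) : EnvRen (.qu Q :: Γ) Γ id id Nat.succ where
  toBoundRen := .shiftQual _ _
  tm h := .qu _ _ _ _ h

theorem Typing.rename {Δ Γ : Env} {χ ρ ξ : ℕ → ℕ} {t : Tm} {T : QTy} (h : Typing Γ t T)
    (hΔ : WfEnv Δ) (hr : EnvRen Δ Γ χ ρ ξ) : Typing Δ (t.rename χ ρ ξ) (T.rename ρ ξ) := by
  induction h generalizing Δ χ ρ ξ with
  | var _ _ _ _ hx => exact .var _ _ _ hΔ (hr.tm hx)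
  | abs _ _ _ _ _ hP h ih =>
    exact .abs _ _ _ _ _ (hP.rename hr.dom)
      (ih (.tm _ _ hΔ (h.wf.1.tm_inv.2.rename hr.dom)) (hr.consTm _))
  | t_abs _ _ _ _ _ hP h ih =>
    exact .t_abs _ _ _ _ _ (hP.rename hr.dom)
      (ih (.ty _ _ hΔ (h.wf.1.ty_inv.2.rename hr.dom)) (hr.consTy _))
  | q_abs _ _ _ _ _ hP h ih =>
    exact .q_abs _ _ _ _ _ (hP.rename hr.dom)
      (ih (.qu _ _ hΔ (h.wf.1.qu_inv.2.rename hr.dom)) (hr.consQu _))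
  | app _ _ _ _ _ _ _ _ ih₁ ih₂ => exact .app _ _ _ _ _ _ (ih₁ hΔ hr) (ih₂ hΔ hr)
  | t_app _ _ _ _ _ _ _ hS ih =>
    rw [Ty.instTy_rename]
    exact .t_app _ _ _ _ _ _ (ih hΔ hr) (hS.rename hΔ hr.toBoundRen)
  | q_app _ _ _ _ _ _ _ hQ ih =>
    rw [Ty.instQual_rename]
    exact .q_app _ _ _ _ _ _ (ih hΔ hr) (hQ.rename hΔ hr.toBoundRen)
  | typ_assert _ _ _ _ _ _ hQ ih =>
    exact .typ_assert _ _ _ _ _ (ih hΔ hr) (hQ.rename hΔ hr.toBoundRen)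
  | typ_upqual _ _ _ _ _ _ hQ ih =>
    exact .typ_upqual _ _ _ _ _ (ih hΔ hr) (hQ.rename hΔ hr.toBoundRen)
  | sub _ _ _ _ _ hs ih => exact .sub _ _ _ _ (ih hΔ hr) (hs.rename hΔ hr.toBoundRen)

/-- A substitution that respects the bounds and types of `Γ`. -/
structure EnvSubst (Δ Γ : Env) (σ : ℕ → Tm) (τ : ℕ → STy) (θ : ℕ → Qual) : Prop
    extends BoundSubst Δ Γ τ θ where
  tm : ∀ {x T}, HasTm Γ x T → Typing Δ (σ x) (T.subst τ θ)

theorem EnvSubst.consTm {Δ Γ : Env} {σ : ℕ → Tm} {τ : ℕ → STy} {θ : ℕ → Qual}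
    (h : EnvSubst Δ Γ σ τ θ) {T : QTy} (hΔ : WfEnv (.tm (T.subst τ θ) :: Δ)) :
    EnvSubst (.tm (T.subst τ θ) :: Δ) (.tm T :: Γ) (Tm.lift σ) τ θ where
  toBoundSubst := h.toBoundSubst.consTm _ hΔ
  tm := by
    rintro x U (_ | ⟨_, _, x, _, hU⟩)
    · exact .var _ _ _ hΔ (.here _ _)
    · simpa only [Ty.rename_id, Tm.lift] using (h.tm hU).rename hΔ (.shiftTm _ _)

theorem EnvSubst.consTy {Δ Γ : Env} {σ : ℕ → Tm} {τ : ℕ → STy} {θ : ℕ → Qual}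
    (h : EnvSubst Δ Γ σ τ θ) {S : STy} (hΔ : WfEnv (.ty (S.subst τ θ) :: Δ)) :
    EnvSubst (.ty (S.subst τ θ) :: Δ) (.ty S :: Γ)
      (fun n => (σ n).rename id Nat.succ id) (Ty.lift τ) θ where
  toBoundSubst := h.toBoundSubst.consTy hΔ
  tm := by
    rintro x U (_ | _ | ⟨_, _, x, U, hU⟩)
    rw [Ty.shiftTy_subst]
    exact (h.tm hU).rename hΔ (.shiftTy _ _)

theorem EnvSubst.consQu {Δ Γ : Env} {σ : ℕ → Tm} {τ : ℕ → STy} {θ : ℕ → Qual}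
    (h : EnvSubst Δ Γ σ τ θ) {Q : Qual} (hΔ : WfEnv (.qu (Q.subst θ) :: Δ)) :
    EnvSubst (.qu (Q.subst θ) :: Δ) (.qu Q :: Γ)
      (fun n => (σ n).rename id id Nat.succ) (fun n => (τ n).shiftQual) (Qual.lift θ) where
  toBoundSubst := h.toBoundSubst.consQu hΔ
  tm := by
    rintro x U (_ | _ | _ | ⟨_, _, x, U, hU⟩)
    rw [Ty.shiftQual_subst]
    exact (h.tm hU).rename hΔ (.shiftQual _ _)

theorem Typing.subst {Δ Γ : Env} {σ : ℕ → Tm} {τ : ℕ → STy} {θ : ℕ → Qual} {t : Tm} {T : QTy}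
    (h : Typing Γ t T) (hΔ : WfEnv Δ) (hs : EnvSubst Δ Γ σ τ θ) :
    Typing Δ (t.subst σ τ θ) (T.subst τ θ) := by
  induction h generalizing Δ σ τ θ with
  | var _ _ _ _ hx => exact hs.tm hx
  | abs _ _ _ _ _ hP h ih =>
    have hΔ' := WfEnv.tm _ _ hΔ (h.wf.1.tm_inv.2.subst hs.wf)
    exact .abs _ _ _ _ _ (hP.subst hs.wf) (ih hΔ' (hs.consTm hΔ'))
  | t_abs _ _ _ _ _ hP h ih =>
    have hΔ' := WfEnv.ty _ _ hΔ (h.wf.1.ty_inv.2.subst hs.wf)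
    exact .t_abs _ _ _ _ _ (hP.subst hs.wf) (ih hΔ' (hs.consTy hΔ'))
  | q_abs _ _ _ _ _ hP h ih =>
    have hΔ' := WfEnv.qu _ _ hΔ (h.wf.1.qu_inv.2.subst hs.wf)
    exact .q_abs _ _ _ _ _ (hP.subst hs.wf) (ih hΔ' (hs.consQu hΔ'))
  | app _ _ _ _ _ _ _ _ ih₁ ih₂ => exact .app _ _ _ _ _ _ (ih₁ hΔ hs) (ih₂ hΔ hs)
  | t_app _ _ _ _ _ _ _ hS ih =>
    rw [Ty.instTy_subst]
    exact .t_app _ _ _ _ _ _ (ih hΔ hs) (hS.subst hΔ hs.toBoundSubst)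
  | q_app _ _ _ _ _ _ _ hQ ih =>
    rw [Ty.instQual_subst]
    exact .q_app _ _ _ _ _ _ (ih hΔ hs) (hQ.subst hΔ hs.toBoundSubst)
  | typ_assert _ _ _ _ _ _ hQ ih =>
    exact .typ_assert _ _ _ _ _ (ih hΔ hs) (hQ.subst hΔ hs.toBoundSubst)
  | typ_upqual _ _ _ _ _ _ hQ ih =>
    exact .typ_upqual _ _ _ _ _ (ih hΔ hs) (hQ.subst hΔ hs.toBoundSubst)
  | sub _ _ _ _ _ hb ih => exact .sub _ _ _ _ (ih hΔ hs) (hb.subst hΔ hs.toBoundSubst)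

theorem Typing.instTm {Γ : Env} {t v : Tm} {T U : QTy} (ht : Typing (.tm U :: Γ) t T)
    (hv : Typing Γ v U) : Typing Γ (t.instTm v) T := by
  have hs : EnvSubst Γ (.tm U :: Γ) (.single v) .var .var := by
    refine ⟨.dropTm hv.wf.1 _, ?_⟩
    rintro x A (_ | ⟨_, _, x, _, hA⟩)
    · rw [Ty.subst_var]; exact hv
    · rw [Ty.subst_var]; exact .var _ _ _ hv.wf.1 hA
  simpa only [Ty.subst_var, Tm.instTm] using ht.subst hv.wf.1 hs

theorem Typing.instTy {Γ : Env} {t : Tm} {S S' : STy} {T : QTy} (ht : Typing (.ty S :: Γ) t T)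
    (hS : Sub Γ S' S) : Typing Γ (t.instTy S') (T.instTy S') := by
  refine ht.subst hS.wf.1 ⟨.singleTy hS, ?_⟩
  rintro x A (_ | _ | ⟨_, _, x, A, hA⟩)
  rw [show Ty.subst _ _ (Ty.shiftTy A) = A from Ty.shiftTy_instTy A S']
  exact .var _ _ _ hS.wf.1 hA

theorem Typing.instQual {Γ : Env} {t : Tm} {Q Q' : Qual} {T : QTy}
    (ht : Typing (.qu Q :: Γ) t T) (hQ : SubQual Γ Q' Q) :
    Typing Γ (t.instQual Q') (T.instQual Q') := by
  refine ht.subst hQ.wf.1 ⟨.singleQual hQ, ?_⟩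
  rintro x A (_ | _ | _ | ⟨_, _, x, A, hA⟩)
  rw [show Ty.subst _ _ (Ty.shiftQual A) = A from Ty.shiftQual_instQual A Q']
  exact .var _ _ _ hQ.wf.1 hA

/-! ### Inversion of typing for values -/

theorem Typing.abs_inv {Γ : Env} {P : Qual} {t : Tm} {T : QTy} (h : Typing Γ (.abs P t) T) :
    ∃ T₁ T₂, Typing (.tm T₁ :: Γ) t T₂ ∧ Sub Γ (.qual P (.arrow T₁ T₂)) T := by
  generalize hs : Tm.abs P t = s at h
  induction h with
  | abs _ _ _ _ _ hP h _ =>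
    cases hs
    have hw := (Typing.abs _ _ _ _ _ hP h).wf
    exact ⟨_, _, h, .refl hw.1 hw.2⟩
  | sub _ _ _ _ _ hb ih =>
    obtain ⟨T₁, T₂, h, hb'⟩ := ih hs
    exact ⟨T₁, T₂, h, hb'.trans hb⟩
  | _ => cases hs

theorem Typing.tabs_inv {Γ : Env} {P : Qual} {S : STy} {t : Tm} {T : QTy}
    (h : Typing Γ (.tabs P S t) T) :
    ∃ U, Typing (.ty S :: Γ) t U ∧ Sub Γ (.qual P (.all S U)) T := by
  generalize hs : Tm.tabs P S t = s at h
  induction h with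
  | t_abs _ _ _ _ _ hP h _ =>
    cases hs
    have hw := (Typing.t_abs _ _ _ _ _ hP h).wf
    exact ⟨_, h, .refl hw.1 hw.2⟩
  | sub _ _ _ _ _ hb ih =>
    obtain ⟨U, h, hb'⟩ := ih hs
    exact ⟨U, h, hb'.trans hb⟩
  | _ => cases hs

theorem Typing.qabs_inv {Γ : Env} {P Q : Qual} {t : Tm} {T : QTy}
    (h : Typing Γ (.qabs P Q t) T) :
    ∃ U, Typing (.qu Q :: Γ) t U ∧ Sub Γ (.qual P (.qall Q U)) T := by
  generalize hs : Tm.qabs P Q t = s at h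
  induction h with
  | q_abs _ _ _ _ _ hP h _ =>
    cases hs
    have hw := (Typing.q_abs _ _ _ _ _ hP h).wf
    exact ⟨_, h, .refl hw.1 hw.2⟩
  | sub _ _ _ _ _ hb ih =>
    obtain ⟨U, h, hb'⟩ := ih hs
    exact ⟨U, h, hb'.trans hb⟩
  | _ => cases hs

theorem Sub.qual_inv {Γ : Env} {P Q : Qual} {S S' : STy} (h : Sub Γ (.qual P S) (.qual Q S')) :
    SubQual Γ P Q ∧ Sub Γ S S' := by
  cases h with | qtype _ _ _ _ _ h₁ h₂ => exact ⟨h₁, h₂⟩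

theorem Sub.arrow_inv {Γ : Env} {T₁ T₂ U₁ U₂ : QTy} (h : Sub Γ (.arrow T₁ T₂) (.arrow U₁ U₂)) :
    Sub Γ U₁ T₁ ∧ Sub Γ T₂ U₂ := by
  cases h with | arrow _ _ _ _ _ h₁ h₂ => exact ⟨h₁, h₂⟩

theorem Sub.all_inv {Γ : Env} {S₁ S₂ : STy} {T₁ T₂ : QTy} (h : Sub Γ (.all S₁ T₁) (.all S₂ T₂)) :
    Sub Γ S₂ S₁ ∧ Sub (.ty S₂ :: Γ) T₁ T₂ := by
  cases h with | all _ _ _ _ _ h₁ h₂ => exact ⟨h₁, h₂⟩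

theorem Sub.qall_inv {Γ : Env} {Q₁ Q₂ : Qual} {T₁ T₂ : QTy}
    (h : Sub Γ (.qall Q₁ T₁) (.qall Q₂ T₂)) :
    SubQual Γ Q₂ Q₁ ∧ Sub (.qu Q₂ :: Γ) T₁ T₂ := by
  cases h with | qall _ _ _ _ _ h₁ h₂ => exact ⟨h₁, h₂⟩

/-- Replacing the tag of a value by `R` changes the qualifier of its type to `R`. -/
theorem Typing.retag {Γ : Env} {v : Tm} {P Q R : Qual} {S : STy} (hv : HasTag v P)
    (h : Typing Γ v (.qual Q S)) (hR : WfQual Γ R) : Typing Γ (v.retag R) (.qual R S) := by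
  have hRR := SubQual.refl h.wf.1 hR
  cases hv with
  | abs =>
    obtain ⟨_, _, ht, hb⟩ := h.abs_inv
    exact .sub _ _ _ _ (.abs _ _ _ _ _ hR ht) (.qtype _ _ _ _ _ hRR hb.qual_inv.2)
  | tabs =>
    obtain ⟨_, ht, hb⟩ := h.tabs_inv
    exact .sub _ _ _ _ (.t_abs _ _ _ _ _ hR ht) (.qtype _ _ _ _ _ hRR hb.qual_inv.2)
  | qabs =>
    obtain ⟨_, ht, hb⟩ := h.qabs_inv
    exact .sub _ _ _ _ (.q_abs _ _ _ _ _ hR ht) (.qtype _ _ _ _ _ hRR hb.qual_inv.2)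

end FsubQ

open FsubQ in
theorem mainTheorem1 (Γ : FsubQ.Env) (s t : FsubQ.Tm) (T : FsubQ.QTy)
    (hs : FsubQ.Typing Γ s T) (hst : FsubQ.Step s t) :
    FsubQ.Typing Γ t T := by
  induction hs generalizing t with
  | var => cases hst
  | abs => cases hst
  | t_abs => cases hst
  | q_abs => cases hst
  | app _ _ _ _ _ _ h₁ h₂ ih₁ ih₂ =>
    cases hst with
    | beta_v =>
      obtain ⟨_, _, ht, hb⟩ := h₁.abs_inv
      obtain ⟨hb₁, hb₂⟩ := hb.qual_inv.2.arrow_inv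
      exact .sub _ _ _ _ (ht.instTm (.sub _ _ _ _ h₂ hb₁)) hb₂
    | app_fun _ _ _ h => exact .app _ _ _ _ _ _ (ih₁ _ h) h₂
    | app_arg _ _ _ _ h => exact .app _ _ _ _ _ _ h₁ (ih₂ _ h)
  | t_app _ _ _ _ _ _ h₁ hS ih =>
    cases hst with
    | beta_T =>
      obtain ⟨_, ht, hb⟩ := h₁.tabs_inv
      obtain ⟨hb₁, hb₂⟩ := hb.qual_inv.2.all_inv
      exact .sub _ _ _ _ (ht.instTy (hS.trans hb₁)) (hb₂.subst hS.wf.1 (.singleTy hS))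
    | tapp_congr _ _ _ h => exact .t_app _ _ _ _ _ _ (ih _ h) hS
  | q_app _ _ _ _ _ _ h₁ hQ ih =>
    cases hst with
    | beta_Q =>
      obtain ⟨_, ht, hb⟩ := h₁.qabs_inv
      obtain ⟨hb₁, hb₂⟩ := hb.qual_inv.2.qall_inv
      exact .sub _ _ _ _ (ht.instQual (hQ.trans hb₁)) (hb₂.subst hQ.wf.1 (.singleQual hQ))
    | qapp_congr _ _ _ h => exact .q_app _ _ _ _ _ _ (ih _ h) hQ
  | typ_assert _ _ _ _ _ h₁ hQ ih =>
    cases hst with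
    | assert => exact h₁
    | assert_congr _ _ _ h => exact .typ_assert _ _ _ _ _ (ih _ h) hQ
  | typ_upqual _ _ _ _ _ h₁ hQ ih =>
    cases hst with
    | upqual _ _ _ hv _ => exact h₁.retag hv hQ.wf.2.2
    | upqual_congr _ _ _ h => exact .typ_upqual _ _ _ _ _ (ih _ h) hQ
  | sub _ _ _ _ _ hb ih => exact .sub _ _ _ _ (ih _ hst) hb
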